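/- Let $\Gamma>0$, $\Omega=[0,\Gamma]\times[0,1]$, and let $\mathrm{Ra}>0$, $\mathrm{Pr}>0$, $L_s\in(0,\infty]$ (with $1/L_s=0$ if $L_s=\infty$). Let $\mathbf u=(u_1,u_2)$, $p$, $T$ be a classical solution, $\Gamma$-periodic in $x_1$, of the two-dimensional Boussinesq system $$\tfrac1{\mathrm{Pr}}(\partial_t\mathbf u+\mathbf u\cdot\nabla\mathbf u)-\Delta\mathbf u+\nabla p=\mathrm{Ra}\,T\,\mathbf e_2,\qquad \nabla\cdot\mathbf u=0,\qquad \partial_tT+\mathbf u\cdot\nabla T-\Delta T=0$$ for $t>0$ and $0<x_2<1$, with boundary conditions $$T=0,\quad u_2=0,\quad \partial_2u_1=-\tfrac1{L_s}u_1\ \text{ at }x_2=1,\qquad T=1,\quad u_2=0,\quad \partial_2u_1=\tfrac1{L_s}u_1\ \text{ at }x_2=0 .$$ Here a classical solution means that, for $t>0$, $\mathbf u$ is $C^1$ in $(t,x)$ and $C^2$ in $x$ up to the boundary $x_2\in\{0,1\}$, $p$ is $C^1$ in $x$ up to the boundary, and $T$ is continuous up to the boundary and, in the interior, differentiable in $t$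 and $C^2$ in $x$. Write $\omega=\partial_1u_2-\partial_2u_1$, and let $\|f\|_{L^q}^q=\int_\Omega|f|^q\,dx$ and $\|f\|_{H^1}^2=\int_\Omega|f|^2\,dx+\int_\Omega|\nabla f|^2\,dx$. **Lemma (Pressure bound).** (i) Let $r>2$. There exists a constant $C>0$ depending only on $r$ and $\Gamma$ (and not on $\mathrm{Ra}$, $\mathrm{Pr}$, $L_s$, the solution or the time) such that for every such solution and every time $t>0$ at which the pressure is normalized by $\int_\Omega p\,dx=0$, $$\|p\|_{H^1}\le C\left(\frac1{L_s}\|\partial_2\mathbf u\|_{L^2}+\frac1{\mathrm{Pr}}\|\omega\|_{L^2}\|\omega\|_{L^r}+\mathrm{Ra}\,\|T\|_{L^2}\right).$$ (ii) For every such solution and every time $t>0$, $$\left|\int_0^\Gamma\left(p\,\partial_1u_1|_{x_2=1}+p\,\partial_1u_1|_{x_2=0}\right)dx_1\right|\le 3\,\|p\|_{H^1}\|\partial_2\mathbf u\|_{L^2}.$$ -/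

import Mathlib

open MeasureTheory Set
open scoped ENNReal

namespace RayleighBenard

noncomputable section

/-- The closed strip `ℝ × [0, 1]`. Functions that are periodic in the first variable are
regarded as functions on this strip. -/
def strip : Set (ℝ × ℝ) := univ ×ˢ Icc (0 : ℝ) 1

/-- The open strip `ℝ × (0, 1)`. -/
def openStrip : Set (ℝ × ℝ) := univ ×ˢ Ioo (0 : ℝ) 1

/-- The period cell `[0, Γ] × [0, 1]`. -/
def cell (Γ : ℝ) : Set (ℝ × ℝ) := Icc (0 : ℝ) Γ ×ˢ Icc (0 : ℝ) 1

/-- Horizontal partial derivative `∂₁ f`. -/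
def d₁ (f : ℝ × ℝ → ℝ) (x : ℝ × ℝ) : ℝ := deriv (fun s => f (s, x.2)) x.1

/-- Vertical partial derivative `∂₂ f` on the strip; at `x₂ = 0` and `x₂ = 1` it is the
one-sided derivative from inside the strip. -/
def d₂ (f : ℝ × ℝ → ℝ) (x : ℝ × ℝ) : ℝ := derivWithin (fun s => f (x.1, s)) (Icc 0 1) x.2

/-- The Laplacian `∂₁² f + ∂₂² f`. -/
def laplacian (f : ℝ × ℝ → ℝ) (x : ℝ × ℝ) : ℝ := d₁ (d₁ f) x + d₂ (d₂ f) x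

/-- The vorticity `∂₁ u₂ - ∂₂ u₁`. -/
def vorticity (u₁ u₂ : ℝ × ℝ → ℝ) (x : ℝ × ℝ) : ℝ := d₁ u₂ x - d₂ u₁ x

/-- The `L^q` norm of a scalar function over the period cell. -/
def lpNorm (Γ q : ℝ) (f : ℝ × ℝ → ℝ) : ℝ := (∫ x in cell Γ, |f x| ^ q) ^ (1 / q)

/-- The `L^q` norm of a planar vector field over the period cell, with the Euclidean
length of the vector. -/
def lpNormVec (Γ q : ℝ) (f g : ℝ × ℝ → ℝ) : ℝ := lpNorm Γ q fun x => √(f x ^ 2 + g x ^ 2)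

/-- The `H¹` norm over the period cell. -/
def h1Norm (Γ : ℝ) (f : ℝ × ℝ → ℝ) : ℝ :=
  √((∫ x in cell Γ, f x ^ 2) + ∫ x in cell Γ, (d₁ f x ^ 2 + d₂ f x ^ 2))

/-- Periodicity with period `Γ` in the horizontal variable, for functions on the strip. -/
def HorizontallyPeriodic (Γ : ℝ) (f : ℝ × ℝ → ℝ) : Prop :=
  ∀ x ∈ strip, f (x.1 + Γ, x.2) = f x

/-- `(u, p, T)` with `u = (u₁, u₂)` is a solution, for all times `t > 0`, of the
two-dimensional Boussinesq system on the strip, horizontally `Γ`-periodic, with temperature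
`1` at the bottom and `0` at the top and Navier-slip boundary conditions for the velocity,
with slip length `Ls ∈ (0, ∞]`. The inverse slip length is `Ls⁻¹.toReal`, so `Ls = ∞` gives
the free-slip condition `∂₂ u₁ = 0`. Functions are evaluated as `u₁ t (x₁, x₂)`. -/
structure IsSolution (Γ Ra Pr : ℝ) (Ls : ℝ≥0∞) (u₁ u₂ p T : ℝ → ℝ × ℝ → ℝ) : Prop where
  /-- the velocity is `C¹` in time and space, up to the walls -/
  u₁_c1 : ContDiffOn ℝ 1 (Function.uncurry u₁) (Ioi 0 ×ˢ strip)
  u₂_c1 : ContDiffOn ℝ 1 (Function.uncurry u₂) (Ioi 0 ×ˢ strip)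
  /-- the velocity is `C²` in space, up to the walls -/
  u₁_c2 : ∀ t > 0, ContDiffOn ℝ 2 (u₁ t) strip
  u₂_c2 : ∀ t > 0, ContDiffOn ℝ 2 (u₂ t) strip
  /-- the pressure is `C¹` in space, up to the walls -/
  p_c1 : ∀ t > 0, ContDiffOn ℝ 1 (p t) strip
  /-- the temperature is continuous up to the walls, and differentiable in time and `C²` in
  space away from them -/
  T_cont : ContinuousOn (Function.uncurry T) (Ioi 0 ×ˢ strip)
  T_time : ∀ t > 0, ∀ x ∈ openStrip, DifferentiableAt ℝ (fun s => T s x) t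
  T_c2 : ∀ t > 0, ContDiffOn ℝ 2 (T t) openStrip
  /-- horizontal periodicity -/
  u₁_periodic : ∀ t > 0, HorizontallyPeriodic Γ (u₁ t)
  u₂_periodic : ∀ t > 0, HorizontallyPeriodic Γ (u₂ t)
  p_periodic : ∀ t > 0, HorizontallyPeriodic Γ (p t)
  T_periodic : ∀ t > 0, HorizontallyPeriodic Γ (T t)
  /-- `Pr⁻¹ (∂ₜ u + u · ∇u) - Δu + ∇p = Ra T e₂`, first component -/
  momentum₁ : ∀ t > 0, ∀ x ∈ openStrip,
    1 / Pr * (deriv (fun s => u₁ s x) t + u₁ t x * d₁ (u₁ t) x + u₂ t x * d₂ (u₁ t) x)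
      - laplacian (u₁ t) x + d₁ (p t) x = 0
  /-- second component -/
  momentum₂ : ∀ t > 0, ∀ x ∈ openStrip,
    1 / Pr * (deriv (fun s => u₂ s x) t + u₁ t x * d₁ (u₂ t) x + u₂ t x * d₂ (u₂ t) x)
      - laplacian (u₂ t) x + d₂ (p t) x = Ra * T t x
  /-- `∇ · u = 0` -/
  incompressible : ∀ t > 0, ∀ x ∈ openStrip, d₁ (u₁ t) x + d₂ (u₂ t) x = 0
  /-- `∂ₜ T + u · ∇T - ΔT = 0` -/
  heat : ∀ t > 0, ∀ x ∈ openStrip,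
    deriv (fun s => T s x) t + u₁ t x * d₁ (T t) x + u₂ t x * d₂ (T t) x
      - laplacian (T t) x = 0
  /-- boundary conditions for the temperature -/
  T_top : ∀ t > 0, ∀ x₁ : ℝ, T t (x₁, 1) = 0
  T_bottom : ∀ t > 0, ∀ x₁ : ℝ, T t (x₁, 0) = 1
  /-- no penetration -/
  u₂_top : ∀ t > 0, ∀ x₁ : ℝ, u₂ t (x₁, 1) = 0
  u₂_bottom : ∀ t > 0, ∀ x₁ : ℝ, u₂ t (x₁, 0) = 0
  /-- Navier slip -/
  slip_top : ∀ t > 0, ∀ x₁ : ℝ, d₂ (u₁ t) (x₁, 1) = -(Ls⁻¹.toReal * u₁ t (x₁, 1))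
  slip_bottom : ∀ t > 0, ∀ x₁ : ℝ, d₂ (u₁ t) (x₁, 0) = Ls⁻¹.toReal * u₁ t (x₁, 0)

end

end RayleighBenard

namespace RayleighBenard

open Filter Topology

/-! For (i), the momentum equation is tested with `∇p`, and each term of the resulting identity for
`∫ |∇p|²` (`integral_sq_grad_pressure`) is estimated.

The time derivative drops out: at every time the velocity is solenoidal and tangential to the walls,
hence orthogonal to each fixed gradient. For the viscous term, `Δu = (-∂₂ω, ∂₁ω)`, so `∇p · Δu` is a
Jacobian of `p` and `ω` and its integral lives on the walls, where the slip condition gives `ω =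
±u₁/Ls`. What remains is `1/Ls` times the integral in (ii). The pressure and the vorticity are only
`C¹`, so Green's identity is needed without second derivatives (`integral_jacobian`).

For convection, `∂₁u` is also solenoidal and tangential, so a constant multiple of it may be added
at no cost: `u₁` is replaced by `u₁ - c` with zero mean. The resulting field `v` is controlled in
every finite `Lᑫ` by `‖ω‖` in `L²`, through Sobolev, Poincaré and `‖∇v‖ = ‖ω‖`. Calderón–Zygmund
bounds for `∇v` in `Lʳ` are avoided: the weighted inequality `∫ |v|²|∇v|² ≤ 3/2 ∫ |v|²ω²`
(`integral_sq_mul_sq_grad_le`) puts the vorticity under the integral directly, and Hölder finishes.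

Every term then carries one factor bounded by the `H¹` norm of `p`; Poincaré bounds the square of
that norm by `∫ |∇p|²`, and one factor cancels.

For (ii) (`abs_integral_wall_le`), the weight `2x₂ - 1`, equal to `±1` on the walls, turns the wall
integral into a cell integral from which all second derivatives of `u₁` cancel. -/

/-! ### Partial derivatives on the closed strip. -/

theorem uniqueDiffOn_strip : UniqueDiffOn ℝ strip :=
  uniqueDiffOn_univ.prod (uniqueDiffOn_Icc zero_lt_one)

theorem mk_mem_strip {x y : ℝ} (hy : y ∈ Icc (0 : ℝ) 1) : ((x, y) : ℝ × ℝ) ∈ strip :=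
  ⟨mem_univ _, hy⟩

theorem cell_subset_strip (Γ : ℝ) : cell Γ ⊆ strip := fun _ hx => ⟨mem_univ _, hx.2⟩

theorem isCompact_cell (Γ : ℝ) : IsCompact (cell Γ) := isCompact_Icc.prod isCompact_Icc

theorem openStrip_subset_strip : openStrip ⊆ strip :=
  fun _ hx => ⟨mem_univ _, Ioo_subset_Icc_self hx.2⟩

theorem isOpen_openStrip : IsOpen openStrip := isOpen_univ.prod isOpen_Ioo

theorem strip_mem_nhds {x : ℝ × ℝ} (hx : x ∈ openStrip) : strip ∈ 𝓝 x :=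
  mem_of_superset (isOpen_openStrip.mem_nhds hx) openStrip_subset_strip

theorem strip_subset_closure_openStrip : strip ⊆ closure openStrip := by
  rw [openStrip, closure_prod_eq, closure_univ, closure_Ioo zero_ne_one]
  exact Subset.rfl

theorem hasDerivAt_fst {f : ℝ × ℝ → ℝ} (hf : DifferentiableOn ℝ f strip) {x y : ℝ}
    (hy : y ∈ Icc (0 : ℝ) 1) :
    HasDerivAt (fun s => f (s, y)) (fderivWithin ℝ f strip (x, y) (1, 0)) x := by
  have h1 := (hf (x, y) (mk_mem_strip hy)).hasFDerivWithinAt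
  have h2 : HasDerivWithinAt (fun s : ℝ => (s, y)) ((1 : ℝ), (0 : ℝ)) univ x :=
    (hasDerivWithinAt_id x univ).prodMk (hasDerivWithinAt_const x univ y)
  have h3 := HasFDerivWithinAt.comp_hasDerivWithinAt (x := x) (f := fun s : ℝ => (s, y)) h1 h2
    (fun s _ => mk_mem_strip hy)
  exact h3.hasDerivAt univ_mem

theorem hasDerivWithinAt_snd {f : ℝ × ℝ → ℝ} (hf : DifferentiableOn ℝ f strip) {x y : ℝ}
    (hy : y ∈ Icc (0 : ℝ) 1) :
    HasDerivWithinAt (fun s => f (x, s)) (fderivWithin ℝ f strip (x, y) (0, 1)) (Icc 0 1) y := by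
  have h1 := (hf (x, y) (mk_mem_strip hy)).hasFDerivWithinAt
  have h2 : HasDerivWithinAt (fun s : ℝ => (x, s)) ((0 : ℝ), (1 : ℝ)) (Icc 0 1) y :=
    (hasDerivWithinAt_const y _ x).prodMk (hasDerivWithinAt_id y _)
  exact HasFDerivWithinAt.comp_hasDerivWithinAt (x := y) (f := fun s : ℝ => (x, s)) h1 h2
    (fun s hs => mk_mem_strip hs)

theorem d₁_eq_fderivWithin {f : ℝ × ℝ → ℝ} (hf : DifferentiableOn ℝ f strip) {x : ℝ × ℝ}
    (hx : x ∈ strip) : d₁ f x = fderivWithin ℝ f strip x (1, 0) :=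
  (hasDerivAt_fst hf hx.2).deriv

theorem d₂_eq_fderivWithin {f : ℝ × ℝ → ℝ} (hf : DifferentiableOn ℝ f strip) {x : ℝ × ℝ}
    (hx : x ∈ strip) : d₂ f x = fderivWithin ℝ f strip x (0, 1) :=
  (hasDerivWithinAt_snd hf hx.2).derivWithin (uniqueDiffOn_Icc zero_lt_one _ hx.2)

theorem hasDerivAt_d₁ {f : ℝ × ℝ → ℝ} (hf : DifferentiableOn ℝ f strip) {x y : ℝ}
    (hy : y ∈ Icc (0 : ℝ) 1) : HasDerivAt (fun s => f (s, y)) (d₁ f (x, y)) x := by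
  rw [d₁_eq_fderivWithin hf (mk_mem_strip hy)]
  exact hasDerivAt_fst hf hy

theorem hasDerivWithinAt_d₂ {f : ℝ × ℝ → ℝ} (hf : DifferentiableOn ℝ f strip) {x y : ℝ}
    (hy : y ∈ Icc (0 : ℝ) 1) :
    HasDerivWithinAt (fun s => f (x, s)) (d₂ f (x, y)) (Icc 0 1) y := by
  rw [d₂_eq_fderivWithin hf (mk_mem_strip hy)]
  exact hasDerivWithinAt_snd hf hy

theorem hasDerivAt_d₂ {f : ℝ × ℝ → ℝ} (hf : DifferentiableOn ℝ f strip) {x y : ℝ}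
    (hy : y ∈ Ioo (0 : ℝ) 1) : HasDerivAt (fun s => f (x, s)) (d₂ f (x, y)) y :=
  (hasDerivWithinAt_d₂ hf (Ioo_subset_Icc_self hy)).hasDerivAt (Icc_mem_nhds hy.1 hy.2)

theorem contDiffOn_d₁ {f : ℝ × ℝ → ℝ} {m n : WithTop ℕ∞} (hf : ContDiffOn ℝ n f strip)
    (hmn : m + 1 ≤ n) : ContDiffOn ℝ m (d₁ f) strip := by
  have hd : DifferentiableOn ℝ f strip := hf.differentiableOn (by rintro rfl; simp at hmn)
  exact ((hf.fderivWithin uniqueDiffOn_strip hmn).clm_apply contDiffOn_const).congr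
    fun x hx => d₁_eq_fderivWithin hd hx

theorem contDiffOn_d₂ {f : ℝ × ℝ → ℝ} {m n : WithTop ℕ∞} (hf : ContDiffOn ℝ n f strip)
    (hmn : m + 1 ≤ n) : ContDiffOn ℝ m (d₂ f) strip := by
  have hd : DifferentiableOn ℝ f strip := hf.differentiableOn (by rintro rfl; simp at hmn)
  exact ((hf.fderivWithin uniqueDiffOn_strip hmn).clm_apply contDiffOn_const).congr
    fun x hx => d₂_eq_fderivWithin hd hx

/-- Symmetry of the full second derivative, available at interior points; this is enough because the
walls are null sets for the integrals. -/
theorem d₁_d₂_comm {f : ℝ × ℝ → ℝ} (hf : ContDiffOn ℝ 2 f strip) {x : ℝ × ℝ}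
    (hx : x ∈ openStrip) : d₁ (d₂ f) x = d₂ (d₁ f) x := by
  have hd : DifferentiableOn ℝ f strip := hf.differentiableOn (by norm_num)
  have hxs := openStrip_subset_strip hx
  have hL : DifferentiableAt ℝ (fderiv ℝ f) x :=
    ((hf.contDiffAt (strip_mem_nhds hx)).fderiv_right (m := 1) (by norm_num)).differentiableAt
      (by norm_num)
  have hsymm : IsSymmSndFDerivAt ℝ f x :=
    (hf.contDiffAt (strip_mem_nhds hx)).isSymmSndFDerivAt (by simp)
  have key : ∀ e : ℝ × ℝ, HasFDerivAt (fun z => fderiv ℝ f z e)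
      ((fderiv ℝ (fderiv ℝ f) x).flip e) x := fun e => by
    simpa using hL.hasFDerivAt.clm_apply (hasFDerivAt_const e x)
  have e1 : d₂ f =ᶠ[𝓝 x] fun z => fderiv ℝ f z (0, 1) := by
    filter_upwards [isOpen_openStrip.mem_nhds hx] with z hz
    rw [d₂_eq_fderivWithin hd (openStrip_subset_strip hz),
      fderivWithin_of_mem_nhds (strip_mem_nhds hz)]
  have e2 : d₁ f =ᶠ[𝓝 x] fun z => fderiv ℝ f z (1, 0) := by
    filter_upwards [isOpen_openStrip.mem_nhds hx] with z hz
    rw [d₁_eq_fderivWithin hd (openStrip_subset_strip hz),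
      fderivWithin_of_mem_nhds (strip_mem_nhds hz)]
  rw [d₁_eq_fderivWithin ((contDiffOn_d₂ hf (m := 1) (by norm_num)).differentiableOn
      (by norm_num)) hxs, d₂_eq_fderivWithin ((contDiffOn_d₁ hf (m := 1)
      (by norm_num)).differentiableOn (by norm_num)) hxs,
    fderivWithin_of_mem_nhds (strip_mem_nhds hx), fderivWithin_of_mem_nhds (strip_mem_nhds hx),
    e1.fderiv_eq, e2.fderiv_eq, (key _).fderiv, (key _).fderiv]
  exact hsymm _ _

/-! ### Periodic `C¹` and `C²` functions and their product rules. -/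

/-- A horizontally periodic function of class `C¹` up to the walls. -/
structure PeriodicC1 (Γ : ℝ) (f : ℝ × ℝ → ℝ) : Prop where
  contDiffOn : ContDiffOn ℝ 1 f strip
  periodic : HorizontallyPeriodic Γ f

namespace PeriodicC1

variable {Γ : ℝ} {f g : ℝ × ℝ → ℝ}

theorem differentiableOn (hf : PeriodicC1 Γ f) : DifferentiableOn ℝ f strip :=
  hf.contDiffOn.differentiableOn (by norm_num)

theorem continuousOn (hf : PeriodicC1 Γ f) : ContinuousOn f strip := hf.contDiffOn.continuousOn

theorem continuousOn_d₁ (hf : PeriodicC1 Γ f) : ContinuousOn (d₁ f) strip :=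
  (contDiffOn_d₁ hf.contDiffOn (m := 0) (by norm_num)).continuousOn

theorem continuousOn_d₂ (hf : PeriodicC1 Γ f) : ContinuousOn (d₂ f) strip :=
  (contDiffOn_d₂ hf.contDiffOn (m := 0) (by norm_num)).continuousOn

theorem mul (hf : PeriodicC1 Γ f) (hg : PeriodicC1 Γ g) : PeriodicC1 Γ (fun x => f x * g x) :=
  ⟨hf.contDiffOn.mul hg.contDiffOn, fun x hx => by simp only [hf.periodic x hx, hg.periodic x hx]⟩

theorem add (hf : PeriodicC1 Γ f) (hg : PeriodicC1 Γ g) : PeriodicC1 Γ (fun x => f x + g x) :=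
  ⟨hf.contDiffOn.add hg.contDiffOn, fun x hx => by simp only [hf.periodic x hx, hg.periodic x hx]⟩

theorem sub (hf : PeriodicC1 Γ f) (hg : PeriodicC1 Γ g) : PeriodicC1 Γ (fun x => f x - g x) :=
  ⟨hf.contDiffOn.sub hg.contDiffOn, fun x hx => by simp only [hf.periodic x hx, hg.periodic x hx]⟩

theorem pow (hf : PeriodicC1 Γ f) (k : ℕ) : PeriodicC1 Γ (fun x => f x ^ k) :=
  ⟨hf.contDiffOn.pow k, fun x hx => by simp only [hf.periodic x hx]⟩

theorem sub_const (hf : PeriodicC1 Γ f) (c : ℝ) : PeriodicC1 Γ (fun x => f x - c) :=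
  ⟨hf.contDiffOn.sub contDiffOn_const, fun x hx => by simp only [hf.periodic x hx]⟩

theorem of_snd {w : ℝ → ℝ} (hw : ContDiff ℝ 1 w) : PeriodicC1 Γ (fun x => w x.2) :=
  ⟨(hw.comp contDiff_snd).contDiffOn, fun _ _ => rfl⟩

theorem d₁_mul (hf : PeriodicC1 Γ f) (hg : PeriodicC1 Γ g) {x : ℝ × ℝ} (hx : x ∈ strip) :
    d₁ (fun x => f x * g x) x = d₁ f x * g x + f x * d₁ g x :=
  ((hasDerivAt_d₁ hf.differentiableOn (x := x.1) hx.2).mul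
    (hasDerivAt_d₁ hg.differentiableOn (x := x.1) hx.2)).deriv

theorem d₂_mul (hf : PeriodicC1 Γ f) (hg : PeriodicC1 Γ g) {x : ℝ × ℝ} (hx : x ∈ strip) :
    d₂ (fun x => f x * g x) x = d₂ f x * g x + f x * d₂ g x :=
  ((hasDerivWithinAt_d₂ hf.differentiableOn (x := x.1) hx.2).mul
    (hasDerivWithinAt_d₂ hg.differentiableOn (x := x.1) hx.2)).derivWithin
      (uniqueDiffOn_Icc zero_lt_one _ hx.2)

theorem d₁_add (hf : PeriodicC1 Γ f) (hg : PeriodicC1 Γ g) {x : ℝ × ℝ} (hx : x ∈ strip) :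
    d₁ (fun x => f x + g x) x = d₁ f x + d₁ g x :=
  ((hasDerivAt_d₁ hf.differentiableOn (x := x.1) hx.2).add
    (hasDerivAt_d₁ hg.differentiableOn (x := x.1) hx.2)).deriv

theorem d₂_add (hf : PeriodicC1 Γ f) (hg : PeriodicC1 Γ g) {x : ℝ × ℝ} (hx : x ∈ strip) :
    d₂ (fun x => f x + g x) x = d₂ f x + d₂ g x :=
  ((hasDerivWithinAt_d₂ hf.differentiableOn (x := x.1) hx.2).add
    (hasDerivWithinAt_d₂ hg.differentiableOn (x := x.1) hx.2)).derivWithin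
      (uniqueDiffOn_Icc zero_lt_one _ hx.2)

theorem d₁_sub (hf : PeriodicC1 Γ f) (hg : PeriodicC1 Γ g) {x : ℝ × ℝ} (hx : x ∈ strip) :
    d₁ (fun x => f x - g x) x = d₁ f x - d₁ g x :=
  ((hasDerivAt_d₁ hf.differentiableOn (x := x.1) hx.2).sub
    (hasDerivAt_d₁ hg.differentiableOn (x := x.1) hx.2)).deriv

theorem d₂_sub (hf : PeriodicC1 Γ f) (hg : PeriodicC1 Γ g) {x : ℝ × ℝ} (hx : x ∈ strip) :
    d₂ (fun x => f x - g x) x = d₂ f x - d₂ g x :=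
  ((hasDerivWithinAt_d₂ hf.differentiableOn (x := x.1) hx.2).sub
    (hasDerivWithinAt_d₂ hg.differentiableOn (x := x.1) hx.2)).derivWithin
      (uniqueDiffOn_Icc zero_lt_one _ hx.2)

theorem d₁_pow (hf : PeriodicC1 Γ f) (k : ℕ) {x : ℝ × ℝ} (hx : x ∈ strip) :
    d₁ (fun x => f x ^ (k + 1)) x = (k + 1) * f x ^ k * d₁ f x := by
  have h := ((hasDerivAt_d₁ hf.differentiableOn (x := x.1) hx.2).fun_pow (k + 1)).deriv
  simpa [d₁] using h

theorem d₂_pow (hf : PeriodicC1 Γ f) (k : ℕ) {x : ℝ × ℝ} (hx : x ∈ strip) :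
    d₂ (fun x => f x ^ (k + 1)) x = (k + 1) * f x ^ k * d₂ f x := by
  have h := ((hasDerivWithinAt_d₂ hf.differentiableOn (x := x.1) hx.2).fun_pow
    (k + 1)).derivWithin (uniqueDiffOn_Icc zero_lt_one _ hx.2)
  simpa [d₂] using h

end PeriodicC1

theorem d₁_sub_const (f : ℝ × ℝ → ℝ) (c : ℝ) : d₁ (fun x => f x - c) = d₁ f := by
  funext x; simp [d₁]

theorem d₂_sub_const (f : ℝ × ℝ → ℝ) (c : ℝ) : d₂ (fun x => f x - c) = d₂ f := by
  funext x; simp [d₂]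

theorem HorizontallyPeriodic.d₁ {Γ : ℝ} {f : ℝ × ℝ → ℝ} (hf : HorizontallyPeriodic Γ f) :
    HorizontallyPeriodic Γ (d₁ f) := fun x hx => by
  have h : (fun s => f (s, x.2)) = fun s => f (s + Γ, x.2) :=
    funext fun s => (hf (s, x.2) ⟨mem_univ _, hx.2⟩).symm
  simp only [RayleighBenard.d₁]
  conv_rhs => rw [h]
  exact (deriv_comp_add_const (fun s => f (s, x.2)) Γ x.1).symm

theorem HorizontallyPeriodic.d₂ {Γ : ℝ} {f : ℝ × ℝ → ℝ} (hf : HorizontallyPeriodic Γ f) :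
    HorizontallyPeriodic Γ (d₂ f) := fun x hx =>
  derivWithin_congr (fun s hs => hf (x.1, s) ⟨mem_univ _, hs⟩) (hf x hx)

/-- A horizontally periodic function of class `C²` up to the walls. -/
structure PeriodicC2 (Γ : ℝ) (f : ℝ × ℝ → ℝ) : Prop where
  contDiffOn : ContDiffOn ℝ 2 f strip
  periodic : HorizontallyPeriodic Γ f

namespace PeriodicC2

variable {Γ : ℝ} {f : ℝ × ℝ → ℝ}

theorem periodicC1 (hf : PeriodicC2 Γ f) : PeriodicC1 Γ f :=
  ⟨hf.contDiffOn.of_le (by norm_num), hf.periodic⟩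

theorem d₁ (hf : PeriodicC2 Γ f) : PeriodicC1 Γ (d₁ f) :=
  ⟨contDiffOn_d₁ hf.contDiffOn (by norm_num), hf.periodic.d₁⟩

theorem d₂ (hf : PeriodicC2 Γ f) : PeriodicC1 Γ (d₂ f) :=
  ⟨contDiffOn_d₂ hf.contDiffOn (by norm_num), hf.periodic.d₂⟩

end PeriodicC2

/-! ### Integrals over the period cell and their slices. -/

theorem volume_cell_lt_top (Γ : ℝ) : volume (cell Γ) < ⊤ := (isCompact_cell Γ).measure_lt_top

theorem measurableSet_cell (Γ : ℝ) : MeasurableSet (cell Γ) :=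
  measurableSet_Icc.prod measurableSet_Icc

theorem integrableOn_cell {f : ℝ × ℝ → ℝ} (hf : ContinuousOn f strip) (Γ : ℝ) :
    IntegrableOn f (cell Γ) :=
  (hf.mono (cell_subset_strip Γ)).integrableOn_compact (isCompact_cell Γ)

/-- The walls have measure zero, so equations known only in the open strip can be used under
integrals over the closed cell. -/
theorem ae_mem_openStrip (Γ : ℝ) : ∀ᵐ x ∂volume.restrict (cell Γ), x ∈ openStrip := by
  have h : ∀ᵐ y : ℝ, y ≠ 0 ∧ y ≠ 1 := by
    filter_upwards [compl_mem_ae_iff.2 (measure_singleton (0 : ℝ)),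
      compl_mem_ae_iff.2 (measure_singleton (1 : ℝ))] with y h0 h1
    exact ⟨h0, h1⟩
  have h2 : ∀ᵐ x : ℝ × ℝ, x.2 ≠ 0 ∧ x.2 ≠ 1 :=
    (Measure.quasiMeasurePreserving_snd (μ := (volume : Measure ℝ))
      (ν := (volume : Measure ℝ))).ae h
  filter_upwards [ae_restrict_of_ae h2, ae_restrict_mem (measurableSet_cell Γ)] with x hx hxc
  exact ⟨mem_univ _, lt_of_le_of_ne hxc.2.1 hx.1.symm, lt_of_le_of_ne hxc.2.2 hx.2⟩

theorem integral_cell_congr {f g : ℝ × ℝ → ℝ} {Γ : ℝ} (h : ∀ x ∈ openStrip, f x = g x) :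
    ∫ x in cell Γ, f x = ∫ x in cell Γ, g x :=
  integral_congr_ae ((ae_mem_openStrip Γ).mono h)

theorem integral_cell_mono {f g : ℝ × ℝ → ℝ} {Γ : ℝ} (hf : ContinuousOn f strip)
    (hg : ContinuousOn g strip) (h : ∀ x ∈ openStrip, f x ≤ g x) :
    ∫ x in cell Γ, f x ≤ ∫ x in cell Γ, g x :=
  integral_mono_ae (integrableOn_cell hf Γ) (integrableOn_cell hg Γ) ((ae_mem_openStrip Γ).mono h)

theorem integral_cell_add {f g : ℝ × ℝ → ℝ} {Γ : ℝ} (hf : ContinuousOn f strip)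
    (hg : ContinuousOn g strip) :
    ∫ x in cell Γ, (f x + g x) = (∫ x in cell Γ, f x) + ∫ x in cell Γ, g x :=
  integral_add (integrableOn_cell hf Γ) (integrableOn_cell hg Γ)

theorem integral_cell_sub {f g : ℝ × ℝ → ℝ} {Γ : ℝ} (hf : ContinuousOn f strip)
    (hg : ContinuousOn g strip) :
    ∫ x in cell Γ, (f x - g x) = (∫ x in cell Γ, f x) - ∫ x in cell Γ, g x :=
  integral_sub (integrableOn_cell hf Γ) (integrableOn_cell hg Γ)

theorem integral_cell_eq_iterated {f : ℝ × ℝ → ℝ} (hf : ContinuousOn f strip) {Γ : ℝ}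
    (hΓ : 0 ≤ Γ) :
    ∫ x in cell Γ, f x = ∫ x in (0 : ℝ)..Γ, ∫ y in (0 : ℝ)..1, f (x, y) := by
  have hi := integrableOn_cell hf Γ
  rw [cell, Measure.volume_eq_prod] at hi ⊢
  rw [setIntegral_prod f hi]
  simp only [intervalIntegral.integral_of_le hΓ, intervalIntegral.integral_of_le zero_le_one,
    integral_Icc_eq_integral_Ioc]

theorem integral_cell_eq_iterated_symm {f : ℝ × ℝ → ℝ} (hf : ContinuousOn f strip) {Γ : ℝ}
    (hΓ : 0 ≤ Γ) :
    ∫ x in cell Γ, f x = ∫ y in (0 : ℝ)..1, ∫ x in (0 : ℝ)..Γ, f (x, y) := by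
  have hi := integrableOn_cell hf Γ
  rw [cell, Measure.volume_eq_prod] at hi ⊢
  rw [IntegrableOn, ← Measure.prod_restrict] at hi
  rw [← Measure.prod_restrict, integral_prod_symm f hi]
  simp only [intervalIntegral.integral_of_le hΓ, intervalIntegral.integral_of_le zero_le_one,
    integral_Icc_eq_integral_Ioc]

theorem continuous_slice_fst {f : ℝ × ℝ → ℝ} (hf : ContinuousOn f strip) {y : ℝ}
    (hy : y ∈ Icc (0 : ℝ) 1) : Continuous fun x => f (x, y) :=
  hf.comp_continuous (by fun_prop) fun _ => mk_mem_strip hy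

theorem continuousOn_slice_snd {f : ℝ × ℝ → ℝ} (hf : ContinuousOn f strip) (x : ℝ) :
    ContinuousOn (fun y => f (x, y)) (Icc 0 1) :=
  hf.comp (by fun_prop) fun _ hy => mk_mem_strip hy

theorem continuousOn_integral_slice_fst {f : ℝ × ℝ → ℝ} (hf : ContinuousOn f strip) (a b : ℝ) :
    ContinuousOn (fun y => ∫ x in a..b, f (x, y)) (Icc 0 1) := by
  -- Projecting the height to `[0, 1]` extends the integrand continuously to the whole plane without
  -- changing it on the strip.
  have hc : Continuous (Function.uncurry fun (y x : ℝ) => f (x, (projIcc 0 1 zero_le_one y : ℝ))) :=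
    hf.comp_continuous (f := fun z : ℝ × ℝ => (z.2, (projIcc 0 1 zero_le_one z.1 : ℝ)))
      (by fun_prop) fun z => mk_mem_strip (projIcc 0 1 zero_le_one z.1).2
  refine (intervalIntegral.continuous_parametric_intervalIntegral_of_continuous' (μ := volume) hc a b
    ).continuousOn.congr fun y hy => ?_
  simp only [projIcc_of_mem zero_le_one hy]

theorem continuous_integral_slice_snd {f : ℝ × ℝ → ℝ} (hf : ContinuousOn f strip) :
    Continuous (fun x => ∫ y in (0 : ℝ)..1, f (x, y)) := by
  have hc : Continuous (Function.uncurry fun (x y : ℝ) => f (x, (projIcc 0 1 zero_le_one y : ℝ))) :=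
    hf.comp_continuous (f := fun z : ℝ × ℝ => (z.1, (projIcc 0 1 zero_le_one z.2 : ℝ)))
      (by fun_prop) fun z => mk_mem_strip (projIcc 0 1 zero_le_one z.2).2
  refine (intervalIntegral.continuous_parametric_intervalIntegral_of_continuous' (μ := volume) hc 0 1
    ).congr fun x => ?_
  refine intervalIntegral.integral_congr fun y hy => ?_
  rw [uIcc_of_le zero_le_one] at hy
  simp only [projIcc_of_mem zero_le_one hy]

theorem intervalIntegrable_slice_snd {f : ℝ × ℝ → ℝ} (hf : ContinuousOn f strip) (x : ℝ) {a b : ℝ}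
    (ha : a ∈ Icc (0 : ℝ) 1) (hb : b ∈ Icc (0 : ℝ) 1) :
    IntervalIntegrable (fun y => f (x, y)) volume a b :=
  ((continuousOn_slice_snd hf x).mono (ordConnected_Icc.uIcc_subset ha hb)).intervalIntegrable

/-! ### Integration by parts and Jacobians of `C¹` functions. -/

namespace PeriodicC1

variable {Γ : ℝ} {F G : ℝ × ℝ → ℝ}

theorem integral_d₁_fst (hF : PeriodicC1 Γ F) {y : ℝ} (hy : y ∈ Icc (0 : ℝ) 1) :
    ∫ x in (0 : ℝ)..Γ, d₁ F (x, y) = 0 := by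
  rw [intervalIntegral.integral_eq_sub_of_hasDerivAt
    (fun x _ => hasDerivAt_d₁ hF.differentiableOn hy)
    ((continuous_slice_fst hF.continuousOn_d₁ hy).intervalIntegrable _ _)]
  simpa [sub_eq_zero] using hF.periodic (0, y) (mk_mem_strip hy)

theorem integral_mul_d₁_fst (hF : PeriodicC1 Γ F) (hG : PeriodicC1 Γ G) {y : ℝ}
    (hy : y ∈ Icc (0 : ℝ) 1) :
    ∫ x in (0 : ℝ)..Γ, F (x, y) * d₁ G (x, y) = -∫ x in (0 : ℝ)..Γ, d₁ F (x, y) * G (x, y) := by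
  have h := (hF.mul hG).integral_d₁_fst hy
  simp_rw [hF.d₁_mul hG (mk_mem_strip hy)] at h
  have c1 : Continuous fun x => d₁ F (x, y) * G (x, y) :=
    (continuous_slice_fst hF.continuousOn_d₁ hy).mul (continuous_slice_fst hG.continuousOn hy)
  have c2 : Continuous fun x => F (x, y) * d₁ G (x, y) :=
    (continuous_slice_fst hF.continuousOn hy).mul (continuous_slice_fst hG.continuousOn_d₁ hy)
  rw [intervalIntegral.integral_add (c1.intervalIntegrable _ _) (c2.intervalIntegrable _ _)] at h
  linarith

theorem integral_d₂_snd (hF : PeriodicC1 Γ F) (x : ℝ) {a b : ℝ} (ha : a ∈ Icc (0 : ℝ) 1)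
    (hb : b ∈ Icc (0 : ℝ) 1) (hab : a ≤ b) :
    ∫ y in a..b, d₂ F (x, y) = F (x, b) - F (x, a) :=
  intervalIntegral.integral_eq_sub_of_hasDerivAt_of_le hab
    ((continuousOn_slice_snd hF.continuousOn x).mono (Icc_subset_Icc ha.1 hb.2))
    (fun _ hy => hasDerivAt_d₂ hF.differentiableOn ⟨ha.1.trans_lt hy.1, hy.2.trans_le hb.2⟩)
    (intervalIntegrable_slice_snd hF.continuousOn_d₂ x ha hb)

theorem integral_d₁ (hF : PeriodicC1 Γ F) (hΓ : 0 ≤ Γ) : ∫ x in cell Γ, d₁ F x = 0 := by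
  rw [integral_cell_eq_iterated_symm hF.continuousOn_d₁ hΓ,
    intervalIntegral.integral_congr (g := fun _ => (0 : ℝ)) fun y hy => ?_]
  · simp
  · rw [uIcc_of_le zero_le_one] at hy
    exact hF.integral_d₁_fst hy

theorem integral_d₂ (hF : PeriodicC1 Γ F) (hΓ : 0 ≤ Γ) :
    ∫ x in cell Γ, d₂ F x = (∫ x in (0 : ℝ)..Γ, F (x, 1)) - ∫ x in (0 : ℝ)..Γ, F (x, 0) := by
  have h0 : (0 : ℝ) ∈ Icc (0 : ℝ) 1 := by simp
  have h1 : (1 : ℝ) ∈ Icc (0 : ℝ) 1 := by simp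
  rw [integral_cell_eq_iterated hF.continuousOn_d₂ hΓ, ← intervalIntegral.integral_sub
    ((continuous_slice_fst hF.continuousOn h1).intervalIntegrable _ _)
    ((continuous_slice_fst hF.continuousOn h0).intervalIntegrable _ _)]
  exact intervalIntegral.integral_congr fun x _ => hF.integral_d₂_snd x h0 h1 zero_le_one

/-- A solenoidal field tangential to the walls is orthogonal to gradients. -/
theorem integral_grad_mul_eq_zero {w₁ w₂ : ℝ × ℝ → ℝ} (hF : PeriodicC1 Γ F)
    (h₁ : PeriodicC1 Γ w₁) (h₂ : PeriodicC1 Γ w₂) (hΓ : 0 ≤ Γ)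
    (hdiv : ∀ x ∈ openStrip, d₁ w₁ x + d₂ w₂ x = 0) (htop : ∀ x, w₂ (x, 1) = 0)
    (hbot : ∀ x, w₂ (x, 0) = 0) :
    ∫ x in cell Γ, (d₁ F x * w₁ x + d₂ F x * w₂ x) = 0 := by
  have e1 := (hF.mul h₁).integral_d₁ hΓ
  have e2 := (hF.mul h₂).integral_d₂ hΓ
  simp only [htop, hbot, mul_zero, intervalIntegral.integral_zero, sub_zero] at e2
  have e3 := integral_cell_add (Γ := Γ) (hF.mul h₁).continuousOn_d₁ (hF.mul h₂).continuousOn_d₂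
  rw [e1, e2, add_zero] at e3
  rw [← e3]
  refine integral_cell_congr fun x hx => ?_
  rw [hF.d₁_mul h₁ (openStrip_subset_strip hx), hF.d₂_mul h₂ (openStrip_subset_strip hx)]
  linear_combination -F x * hdiv x hx

theorem exists_abs_snd_sub_le (hF : PeriodicC1 Γ F) :
    ∃ K : ℝ, 0 ≤ K ∧ ∀ x ∈ Icc (0 : ℝ) Γ, ∀ a ∈ Icc (0 : ℝ) 1, ∀ b ∈ Icc (0 : ℝ) 1,
      |F (x, b) - F (x, a)| ≤ K * |b - a| := by
  obtain ⟨K, hK⟩ := (isCompact_cell Γ).exists_bound_of_continuousOn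
    (hF.continuousOn_d₂.mono (cell_subset_strip Γ))
  refine ⟨|K|, abs_nonneg K, fun x hx a ha b hb => ?_⟩
  exact Convex.norm_image_sub_le_of_norm_hasDerivWithin_le (f := fun y => F (x, y))
    (fun y hy => hasDerivWithinAt_d₂ hF.differentiableOn hy)
    (fun y hy => (hK (x, y) ⟨hx, hy⟩).trans (le_abs_self K)) (convex_Icc 0 1) ha hb

/-- Formally the derivative contains `F ∂₂∂₁G`, which need not exist. A horizontal integration by
parts at the level of difference quotients moves `∂₁` from the increment of `G` onto `F`; the limit
then involves first derivatives only and follows by dominated convergence, with Lipschitz bounds for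
the slopes. -/
theorem hasDerivAt_integral_mul_d₁ (hF : PeriodicC1 Γ F) (hG : PeriodicC1 Γ G) (hΓ : 0 ≤ Γ)
    {a : ℝ} (ha : a ∈ Ioo (0 : ℝ) 1) :
    HasDerivAt (fun y => ∫ x in (0 : ℝ)..Γ, F (x, y) * d₁ G (x, y))
      (∫ x in (0 : ℝ)..Γ, (d₂ F (x, a) * d₁ G (x, a) - d₁ F (x, a) * d₂ G (x, a))) a := by
  have ha' := Ioo_subset_Icc_self ha
  obtain ⟨K, hK0, hK⟩ := hF.exists_abs_snd_sub_le
  obtain ⟨L, hL0, hL⟩ := hG.exists_abs_snd_sub_le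
  obtain ⟨B, hB⟩ := (isCompact_cell Γ).exists_bound_of_continuousOn
    (hF.continuousOn_d₁.mono (cell_subset_strip Γ))
  obtain ⟨D, hD⟩ := (isCompact_cell Γ).exists_bound_of_continuousOn
    (hG.continuousOn_d₁.mono (cell_subset_strip Γ))
  have hev : ∀ᶠ b in 𝓝[≠] a, b ∈ Ioo (0 : ℝ) 1 ∧ b ≠ a :=
    (eventually_nhdsWithin_of_eventually_nhds (isOpen_Ioo.mem_nhds ha)).and
      eventually_mem_nhdsWithin
  have cF := fun {y : ℝ} (hy : y ∈ Icc (0 : ℝ) 1) => continuous_slice_fst hF.continuousOn hy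
  have cG := fun {y : ℝ} (hy : y ∈ Icc (0 : ℝ) 1) => continuous_slice_fst hG.continuousOn hy
  have cF1 := fun {y : ℝ} (hy : y ∈ Icc (0 : ℝ) 1) => continuous_slice_fst hF.continuousOn_d₁ hy
  have cG1 := fun {y : ℝ} (hy : y ∈ Icc (0 : ℝ) 1) => continuous_slice_fst hG.continuousOn_d₁ hy
  rw [hasDerivAt_iff_tendsto_slope]
  have hslope : ∀ᶠ b in 𝓝[≠] a,
      (∫ x in (0 : ℝ)..Γ, (slope (fun y => F (x, y)) a b * d₁ G (x, b)
        - d₁ F (x, a) * slope (fun y => G (x, y)) a b)) =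
      slope (fun y => ∫ x in (0 : ℝ)..Γ, F (x, y) * d₁ G (x, y)) a b := by
    filter_upwards [hev] with b hb
    have hb' := Ioo_subset_Icc_self hb.1
    have p1 := hF.integral_mul_d₁_fst hG ha'
    have hi := fun {f : ℝ → ℝ} (hf : Continuous f) =>
      hf.intervalIntegrable (μ := volume) (0 : ℝ) Γ
    have p2 : ∫ x in (0 : ℝ)..Γ, F (x, a) * d₁ G (x, b) =
        -∫ x in (0 : ℝ)..Γ, d₁ F (x, a) * G (x, b) := by
      -- Freezing `G` at height `b` gives a function independent of the vertical variable, so the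
      -- integration by parts at height `a` applies to factors taken at two different heights.
      have hG' : PeriodicC1 Γ (fun x => G (x.1, b)) :=
        ⟨hG.contDiffOn.comp (contDiff_fst.prodMk contDiff_const).contDiffOn
          fun x _ => mk_mem_strip hb', fun x _ => hG.periodic (x.1, b) (mk_mem_strip hb')⟩
      exact hF.integral_mul_d₁_fst hG' ha'
    simp only [slope_def_field, div_eq_inv_mul]
    have m1 : ∀ {y z : ℝ}, y ∈ Icc (0 : ℝ) 1 → z ∈ Icc (0 : ℝ) 1 →
        Continuous fun x => F (x, y) * d₁ G (x, z) := fun hy hz => (cF hy).mul (cG1 hz)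
    have m2 : ∀ {y z : ℝ}, y ∈ Icc (0 : ℝ) 1 → z ∈ Icc (0 : ℝ) 1 →
        Continuous fun x => d₁ F (x, y) * G (x, z) := fun hy hz => (cF1 hy).mul (cG hz)
    rw [← intervalIntegral.integral_sub (hi (m1 hb' hb')) (hi (m1 ha' ha')),
      ← intervalIntegral.integral_const_mul]
    rw [← sub_eq_zero, ← intervalIntegral.integral_sub]
    · have e : ∀ x, ((b - a)⁻¹ * (F (x, b) - F (x, a)) * d₁ G (x, b) -
          d₁ F (x, a) * ((b - a)⁻¹ * (G (x, b) - G (x, a))) -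
          (b - a)⁻¹ * (F (x, b) * d₁ G (x, b) - F (x, a) * d₁ G (x, a))) =
          (b - a)⁻¹ * ((F (x, a) * d₁ G (x, a) + d₁ F (x, a) * G (x, a)) -
            (F (x, a) * d₁ G (x, b) + d₁ F (x, a) * G (x, b))) := fun x => by ring
      simp only [e]
      rw [intervalIntegral.integral_const_mul, intervalIntegral.integral_sub,
        intervalIntegral.integral_add (hi (m1 ha' ha')) (hi (m2 ha' ha')),
        intervalIntegral.integral_add (hi (m1 ha' hb')) (hi (m2 ha' hb')),
        p1, p2]
      · ring
      · exact hi (((cF ha').mul (cG1 ha')).add ((cF1 ha').mul (cG ha')))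
      · exact hi (((cF ha').mul (cG1 hb')).add ((cF1 ha').mul (cG hb')))
    · exact hi (((continuous_const.mul ((cF hb').sub (cF ha'))).mul (cG1 hb')).sub
        ((cF1 ha').mul (continuous_const.mul ((cG hb').sub (cG ha')))))
    · exact hi (continuous_const.mul (((cF hb').mul (cG1 hb')).sub ((cF ha').mul (cG1 ha'))))
  refine Tendsto.congr' hslope ?_
  refine intervalIntegral.tendsto_integral_filter_of_dominated_convergence
    (fun _ => K * D + B * L) ?_ ?_ (by simp) ?_
  · filter_upwards [hev] with b hb
    have hb' := Ioo_subset_Icc_self hb.1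
    simp only [slope_def_field]
    exact Continuous.aestronglyMeasurable
      (((((cF hb').sub (cF ha')).div_const _).mul (cG1 hb')).sub
        ((cF1 ha').mul (((cG hb').sub (cG ha')).div_const _)))
  · filter_upwards [hev] with b hb
    have hb' := Ioo_subset_Icc_self hb.1
    have hpos : 0 < |b - a| := abs_pos.2 (sub_ne_zero.2 hb.2)
    refine ae_of_all _ fun x hx => ?_
    rw [uIoc_of_le hΓ] at hx
    have hx' := Ioc_subset_Icc_self hx
    simp only [slope_def_field]
    refine (norm_sub_le _ _).trans (add_le_add ?_ ?_)
    · rw [norm_mul, norm_div]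
      exact mul_le_mul ((div_le_iff₀ hpos).2 (hK x hx' a ha' b hb')) (hD (x, b) ⟨hx', hb'⟩)
        (norm_nonneg _) hK0
    · rw [norm_mul, norm_div]
      exact mul_le_mul (hB (x, a) ⟨hx', ha'⟩) ((div_le_iff₀ hpos).2 (hL x hx' a ha' b hb'))
        (by positivity) ((norm_nonneg _).trans (hB (x, a) ⟨hx', ha'⟩))
  · refine ae_of_all _ fun x _ => ?_
    have t1 := hasDerivAt_iff_tendsto_slope.1 (hasDerivAt_d₂ hF.differentiableOn (x := x) ha)
    have t2 := hasDerivAt_iff_tendsto_slope.1 (hasDerivAt_d₂ hG.differentiableOn (x := x) ha)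
    have t3 : Tendsto (fun b => d₁ G (x, b)) (𝓝[≠] a) (𝓝 (d₁ G (x, a))) :=
      (((continuousOn_slice_snd hG.continuousOn_d₁ x).continuousAt
        (Icc_mem_nhds ha.1 ha.2)).tendsto).mono_left nhdsWithin_le_nhds
    exact (t1.mul t3).sub (tendsto_const_nhds.mul t2)

/-- Green's identity for the Jacobian determinant of two functions that are only `C¹`. -/
theorem integral_jacobian (hF : PeriodicC1 Γ F) (hG : PeriodicC1 Γ G) (hΓ : 0 ≤ Γ) :
    ∫ x in cell Γ, (d₂ F x * d₁ G x - d₁ F x * d₂ G x) =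
      (∫ x in (0 : ℝ)..Γ, F (x, 1) * d₁ G (x, 1)) - ∫ x in (0 : ℝ)..Γ, F (x, 0) * d₁ G (x, 0) := by
  have hc : ContinuousOn (fun x => d₂ F x * d₁ G x - d₁ F x * d₂ G x) strip :=
    (hF.continuousOn_d₂.mul hG.continuousOn_d₁).sub (hF.continuousOn_d₁.mul hG.continuousOn_d₂)
  rw [integral_cell_eq_iterated_symm hc hΓ]
  refine intervalIntegral.integral_eq_sub_of_hasDerivAt_of_le zero_le_one
    (continuousOn_integral_slice_fst (hF.continuousOn.mul hG.continuousOn_d₁) 0 Γ)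
    (fun y hy => hF.hasDerivAt_integral_mul_d₁ hG hΓ hy) ?_
  refine ContinuousOn.intervalIntegrable ?_
  rw [uIcc_of_le zero_le_one]
  exact continuousOn_integral_slice_fst hc 0 Γ

theorem integral_jacobian_eq_zero (hF : PeriodicC1 Γ F) (hG : PeriodicC1 Γ G) (hΓ : 0 ≤ Γ)
    (htop : ∀ x, F (x, 1) = 0) (hbot : ∀ x, F (x, 0) = 0) :
    ∫ x in cell Γ, (d₂ F x * d₁ G x - d₁ F x * d₂ G x) = 0 := by
  rw [hF.integral_jacobian hG hΓ]
  simp [htop, hbot]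

end PeriodicC1

/-! ### Cauchy–Schwarz, Sobolev and Poincaré inequalities on the cell. -/

theorem sq_integral_mul_le {α : Type*} [MeasurableSpace α] {μ : Measure α} {f g : α → ℝ}
    (hf : Integrable (fun x => f x ^ 2) μ) (hg : Integrable (fun x => g x ^ 2) μ)
    (hfg : Integrable (fun x => f x * g x) μ) :
    (∫ x, f x * g x ∂μ) ^ 2 ≤ (∫ x, f x ^ 2 ∂μ) * ∫ x, g x ^ 2 ∂μ := by
  have h : ∀ t : ℝ, 0 ≤ (∫ x, f x ^ 2 ∂μ) * (t * t) + (2 * ∫ x, f x * g x ∂μ) * t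
      + ∫ x, g x ^ 2 ∂μ := fun t => by
    have e : ∫ x, (f x * t + g x) ^ 2 ∂μ = (∫ x, f x ^ 2 ∂μ) * (t * t)
        + (2 * ∫ x, f x * g x ∂μ) * t + ∫ x, g x ^ 2 ∂μ := by
      have e1 : ∀ x, (f x * t + g x) ^ 2 = f x ^ 2 * (t * t) + f x * g x * (2 * t) + g x ^ 2 :=
        fun x => by ring
      simp only [e1]
      rw [integral_add _ hg, integral_add (hf.mul_const _) (hfg.mul_const _),
        integral_mul_const, integral_mul_const]
      · ring
      · exact (hf.mul_const _).add (hfg.mul_const _)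
    rw [← e]
    exact integral_nonneg fun x => sq_nonneg _
  have := discrim_le_zero h
  rw [discrim] at this
  linarith

theorem sq_integral_cell_mul_le {f g : ℝ × ℝ → ℝ} (hf : ContinuousOn f strip)
    (hg : ContinuousOn g strip) (Γ : ℝ) :
    (∫ x in cell Γ, f x * g x) ^ 2 ≤ (∫ x in cell Γ, f x ^ 2) * ∫ x in cell Γ, g x ^ 2 :=
  sq_integral_mul_le (integrableOn_cell (hf.fun_pow 2) Γ) (integrableOn_cell (hg.fun_pow 2) Γ)
    (integrableOn_cell (hf.mul hg) Γ)

theorem abs_integral_cell_mul_le {f g : ℝ × ℝ → ℝ} (hf : ContinuousOn f strip)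
    (hg : ContinuousOn g strip) (Γ : ℝ) :
    |∫ x in cell Γ, f x * g x| ≤ √(∫ x in cell Γ, f x ^ 2) * √(∫ x in cell Γ, g x ^ 2) := by
  rw [← Real.sqrt_mul (integral_nonneg fun x => sq_nonneg _)]
  exact Real.abs_le_sqrt (sq_integral_cell_mul_le hf hg Γ)

theorem measureReal_cell {Γ : ℝ} (hΓ : 0 ≤ Γ) : (volume : Measure (ℝ × ℝ)).real (cell Γ) = Γ := by
  rw [cell, Measure.volume_eq_prod, measureReal_prod_prod]
  simp [hΓ]

theorem integral_cell_const {Γ : ℝ} (hΓ : 0 ≤ Γ) (c : ℝ) : ∫ _ in cell Γ, c = Γ * c := by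
  rw [setIntegral_const, measureReal_cell hΓ, smul_eq_mul]

theorem abs_sub_le_integral_abs_deriv {α β : ℝ} {g g' : ℝ → ℝ}
    (hg : ContinuousOn g (Icc α β)) (hg' : ContinuousOn g' (Icc α β))
    (h : ∀ y ∈ Ioo α β, HasDerivAt g (g' y) y) {a b : ℝ} (ha : a ∈ Icc α β) (hb : b ∈ Icc α β) :
    |g b - g a| ≤ ∫ y in α..β, |g' y| := by
  wlog hab : a ≤ b generalizing a b
  · rw [abs_sub_comm]
    exact this hb ha (le_of_not_ge hab)
  have hsub : Icc a b ⊆ Icc α β := Icc_subset_Icc ha.1 hb.2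
  have hαβ : α ≤ β := ha.1.trans ha.2
  rw [← intervalIntegral.integral_eq_sub_of_hasDerivAt_of_le hab (hg.mono hsub)
    (fun y hy => h y ⟨ha.1.trans_lt hy.1, hy.2.trans_le hb.2⟩)
    ((hg'.mono hsub).intervalIntegrable_of_Icc hab)]
  refine (intervalIntegral.abs_integral_le_integral_abs hab).trans ?_
  exact intervalIntegral.integral_mono_interval ha.1 hab hb.2
    (ae_of_all _ fun y => abs_nonneg _) (hg'.abs.intervalIntegrable_of_Icc hαβ)

/-- Averaging `|g b| ≤ |g s| + ∫ |g'|` over `s` gives the one-dimensional embedding of `W^{1,1}`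
into bounded functions. -/
theorem abs_le_integral_abs_add_abs_deriv {α β : ℝ} (hαβ : α < β) {g g' : ℝ → ℝ}
    (hg : ContinuousOn g (Icc α β)) (hg' : ContinuousOn g' (Icc α β))
    (h : ∀ y ∈ Ioo α β, HasDerivAt g (g' y) y) {b : ℝ} (hb : b ∈ Icc α β) :
    |g b| ≤ ∫ y in α..β, ((β - α)⁻¹ * |g y| + |g' y|) := by
  have hpos : 0 < β - α := sub_pos.2 hαβ
  have i1 : IntervalIntegrable (fun y => |g y|) volume α β :=
    hg.abs.intervalIntegrable_of_Icc hαβ.le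
  have i2 : IntervalIntegrable (fun y => |g' y|) volume α β :=
    hg'.abs.intervalIntegrable_of_Icc hαβ.le
  rw [intervalIntegral.integral_add (i1.const_mul _) i2, intervalIntegral.integral_const_mul]
  have h1 : ∫ _ in α..β, |g b| ≤ ∫ s in α..β, (|g s| + ∫ y in α..β, |g' y|) := by
    refine intervalIntegral.integral_mono_on hαβ.le (by simp) (i1.add (by simp)) fun s hs => ?_
    have h2 := abs_sub_le_integral_abs_deriv hg hg' h hs hb
    have h3 := abs_sub_abs_le_abs_sub (g b) (g s)
    linarith
  rw [intervalIntegral.integral_add i1 (by simp), intervalIntegral.integral_const,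
    intervalIntegral.integral_const, smul_eq_mul, smul_eq_mul] at h1
  rw [← mul_le_mul_iff_right₀ hpos]
  refine h1.trans (le_of_eq ?_)
  field_simp

namespace PeriodicC1

variable {Γ : ℝ} {f : ℝ × ℝ → ℝ}

theorem abs_sub_le_fst (hf : PeriodicC1 Γ f) {y a b : ℝ} (hy : y ∈ Icc (0 : ℝ) 1)
    (ha : a ∈ Icc 0 Γ) (hb : b ∈ Icc 0 Γ) :
    |f (b, y) - f (a, y)| ≤ ∫ x in (0 : ℝ)..Γ, |d₁ f (x, y)| :=
  abs_sub_le_integral_abs_deriv (g := fun x => f (x, y))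
    (continuous_slice_fst hf.continuousOn hy).continuousOn
    (continuous_slice_fst hf.continuousOn_d₁ hy).continuousOn
    (fun _ _ => hasDerivAt_d₁ hf.differentiableOn hy) ha hb

theorem abs_sub_le_snd (hf : PeriodicC1 Γ f) (x : ℝ) {a b : ℝ}
    (ha : a ∈ Icc (0 : ℝ) 1) (hb : b ∈ Icc (0 : ℝ) 1) :
    |f (x, b) - f (x, a)| ≤ ∫ y in (0 : ℝ)..1, |d₂ f (x, y)| :=
  abs_sub_le_integral_abs_deriv (g := fun y => f (x, y))
    (continuousOn_slice_snd hf.continuousOn x) (continuousOn_slice_snd hf.continuousOn_d₂ x)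
    (fun _ hy => hasDerivAt_d₂ hf.differentiableOn hy) ha hb

/-- The embedding `W^{1,1} ⊆ L²` on the period cell. -/
theorem integral_sq_le (hf : PeriodicC1 Γ f) (hΓ : 0 < Γ) :
    ∫ x in cell Γ, f x ^ 2 ≤
      (∫ x in cell Γ, (|f x| + |d₂ f x|)) * ∫ x in cell Γ, (Γ⁻¹ * |f x| + |d₁ f x|) := by
  have ca : ContinuousOn (fun x => |f x| + |d₂ f x|) strip :=
    hf.continuousOn.abs.add hf.continuousOn_d₂.abs
  have cb : ContinuousOn (fun x => Γ⁻¹ * |f x| + |d₁ f x|) strip :=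
    (continuousOn_const.mul hf.continuousOn.abs).add hf.continuousOn_d₁.abs
  have cb' := continuousOn_integral_slice_fst cb 0 Γ
  have ca' := continuous_integral_slice_snd ca
  rw [integral_cell_eq_iterated ca hΓ.le, integral_cell_eq_iterated_symm cb hΓ.le,
    integral_cell_eq_iterated (hf.continuousOn.fun_pow 2) hΓ.le,
    ← intervalIntegral.integral_mul_const]
  refine intervalIntegral.integral_mono_on hΓ.le
    ((continuous_integral_slice_snd (hf.continuousOn.fun_pow 2)).intervalIntegrable _ _) ?_
    fun x hx => ?_
  · exact (ca'.mul continuous_const).intervalIntegrable _ _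
  · rw [← intervalIntegral.integral_const_mul]
    refine intervalIntegral.integral_mono_on zero_le_one
      (intervalIntegrable_slice_snd (hf.continuousOn.fun_pow 2) x (by simp) (by simp))
      ((continuousOn_const.mul cb').intervalIntegrable_of_Icc zero_le_one) fun y hy => ?_
    -- Gagliardo's argument: one factor of `|f|²` is bounded by a function of `x` alone and the
    -- other by a function of `y` alone, so the double integral factorizes.
    have h1 : |f (x, y)| ≤ ∫ s in (0 : ℝ)..1, (|f (x, s)| + |d₂ f (x, s)|) := by
      simpa using abs_le_integral_abs_add_abs_deriv (g := fun y => f (x, y)) zero_lt_one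
        (continuousOn_slice_snd hf.continuousOn x) (continuousOn_slice_snd hf.continuousOn_d₂ x)
        (fun _ hy => hasDerivAt_d₂ hf.differentiableOn hy) hy
    have h2 : |f (x, y)| ≤ ∫ s in (0 : ℝ)..Γ, (Γ⁻¹ * |f (s, y)| + |d₁ f (s, y)|) := by
      simpa using abs_le_integral_abs_add_abs_deriv (g := fun x => f (x, y)) hΓ
        (continuous_slice_fst hf.continuousOn hy).continuousOn
        (continuous_slice_fst hf.continuousOn_d₁ hy).continuousOn
        (fun _ _ => hasDerivAt_d₁ hf.differentiableOn hy) hx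
    rw [← sq_abs, sq]
    exact mul_le_mul h1 h2 (abs_nonneg _) ((abs_nonneg _).trans h1)

theorem continuousOn_sq_grad (hf : PeriodicC1 Γ f) :
    ContinuousOn (fun x => d₁ f x ^ 2 + d₂ f x ^ 2) strip :=
  (hf.continuousOn_d₁.fun_pow 2).add (hf.continuousOn_d₂.fun_pow 2)

theorem sq_h1Norm (Γ : ℝ) (f : ℝ × ℝ → ℝ) : h1Norm Γ f ^ 2 =
    (∫ x in cell Γ, f x ^ 2) + ∫ x in cell Γ, (d₁ f x ^ 2 + d₂ f x ^ 2) :=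
  Real.sq_sqrt (add_nonneg (integral_nonneg fun _ => by positivity)
    (integral_nonneg fun _ => by positivity))

/-- The embedding `H¹ ⊆ L^{2k}` on the period cell. -/
theorem exists_integral_pow_le_h1Norm (hΓ : 0 < Γ) (k : ℕ) : ∃ C : ℝ, 0 ≤ C ∧
    ∀ f : ℝ × ℝ → ℝ, PeriodicC1 Γ f →
      ∫ x in cell Γ, (f x ^ k) ^ 2 ≤ C * (h1Norm Γ f ^ 2) ^ k := by
  induction k with
  | zero => exact ⟨Γ, hΓ.le, fun f _ => by simp [measureReal_cell hΓ.le]⟩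
  | succ k ih =>
    obtain ⟨C, hC0, hC⟩ := ih
    -- The `W^{1,1}` embedding is applied to `f ^ (k + 1)`, whose gradient is `(k + 1) f ^ k ∇f`. By
    -- Cauchy–Schwarz the factor `f ^ k` is handled by the induction hypothesis; `M` bounds the
    -- other factor for both weights `c = 1` and `c = Γ⁻¹`.
    set M : ℝ := 2 * Γ⁻¹ ^ 2 + 2 * (k + 1) ^ 2 with hM
    have hM0 : 0 ≤ M := by positivity
    refine ⟨C * M, by positivity, fun f hf => ?_⟩
    set E := h1Norm Γ f ^ 2 with hE
    have hE0 : 0 ≤ E := sq_nonneg _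
    have hEI : E = ∫ x in cell Γ, (f x ^ 2 + (d₁ f x ^ 2 + d₂ f x ^ 2)) := by
      rw [hE, sq_h1Norm, integral_cell_add (hf.continuousOn.fun_pow 2) hf.continuousOn_sq_grad]
    have key : ∀ (c : ℝ) (g : ℝ × ℝ → ℝ), ContinuousOn g strip →
        (∀ x, (c * |f x| + (k + 1) * |g x|) ^ 2 ≤ M * (f x ^ 2 + (d₁ f x ^ 2 + d₂ f x ^ 2))) →
        (∫ x in cell Γ, |f x ^ k| * (c * |f x| + (k + 1) * |g x|)) ^ 2 ≤ C * E ^ k * (M * E) := by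
      intro c g hg hle
      have c1 : ContinuousOn (fun x => |f x ^ k|) strip := (hf.continuousOn.pow k).abs
      have c2 : ContinuousOn (fun x => c * |f x| + (k + 1) * |g x|) strip :=
        (continuousOn_const.mul hf.continuousOn.abs).add (continuousOn_const.mul hg.abs)
      refine (sq_integral_cell_mul_le c1 c2 Γ).trans ?_
      simp only [sq_abs]
      refine mul_le_mul (hC f hf) ?_ (integral_nonneg fun _ => sq_nonneg _) (by positivity)
      rw [hEI, ← integral_const_mul]
      exact integral_cell_mono (c2.fun_pow 2)
        (continuousOn_const.mul ((hf.continuousOn.fun_pow 2).add hf.continuousOn_sq_grad))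
        fun x _ => hle x
    have k1 := key 1 (d₂ f) hf.continuousOn_d₂ fun x => by
      have h1 : (1 : ℝ) ≤ (k + 1) ^ 2 := by nlinarith [(Nat.cast_nonneg k : (0 : ℝ) ≤ k)]
      have h2 : 0 ≤ 2 * Γ⁻¹ ^ 2 * (f x ^ 2 + (d₁ f x ^ 2 + d₂ f x ^ 2)) := by positivity
      have h3 := sq_nonneg (|f x| - (k + 1) * |d₂ f x|)
      have h4 : 0 ≤ 2 * ((k : ℝ) + 1) ^ 2 * d₁ f x ^ 2 := by positivity
      have h5 := mul_le_mul_of_nonneg_right h1 (sq_nonneg (f x))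
      rw [hM]
      nlinarith [sq_abs (f x), sq_abs (d₂ f x)]
    have k2 := key Γ⁻¹ (d₁ f) hf.continuousOn_d₁ fun x => by
      have h2 : 0 ≤ 2 * Γ⁻¹ ^ 2 * (d₁ f x ^ 2 + d₂ f x ^ 2) := by positivity
      have h3 := sq_nonneg (Γ⁻¹ * |f x| - (k + 1) * |d₁ f x|)
      have h4 : 0 ≤ 2 * ((k : ℝ) + 1) ^ 2 * d₂ f x ^ 2 := by positivity
      have h5 : 0 ≤ 2 * ((k : ℝ) + 1) ^ 2 * f x ^ 2 := by positivity
      rw [hM]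
      nlinarith [sq_abs (f x), sq_abs (d₁ f x)]
    refine ((hf.pow (k + 1)).integral_sq_le hΓ).trans ?_
    have e1 : ∫ x in cell Γ, (|f x ^ (k + 1)| + |d₂ (fun x => f x ^ (k + 1)) x|) =
        ∫ x in cell Γ, |f x ^ k| * (1 * |f x| + (k + 1) * |d₂ f x|) :=
      integral_cell_congr fun x hx => by
        rw [hf.d₂_pow k (openStrip_subset_strip hx), pow_succ, abs_mul, abs_mul, abs_mul,
          abs_of_nonneg (by positivity : (0 : ℝ) ≤ k + 1)]
        ring
    have e2 : ∫ x in cell Γ, (Γ⁻¹ * |f x ^ (k + 1)| + |d₁ (fun x => f x ^ (k + 1)) x|) =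
        ∫ x in cell Γ, |f x ^ k| * (Γ⁻¹ * |f x| + (k + 1) * |d₁ f x|) :=
      integral_cell_congr fun x hx => by
        rw [hf.d₁_pow k (openStrip_subset_strip hx), pow_succ, abs_mul, abs_mul, abs_mul,
          abs_of_nonneg (by positivity : (0 : ℝ) ≤ k + 1)]
        ring
    rw [e1, e2]
    calc _ ≤ C * E ^ k * (M * E) := by
          -- Both integrals are known only through the same bound on their squares, so the product
          -- is compared after squaring.
          refine le_of_sq_le_sq ?_ (by positivity)
          rw [mul_pow, sq (C * E ^ k * (M * E))]
          exact mul_le_mul k1 k2 (sq_nonneg _) (by positivity)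
      _ = C * M * E ^ (k + 1) := by ring

/-- The Poincaré inequality on the period cell. -/
theorem integral_sq_le_of_integral_eq_zero (hf : PeriodicC1 Γ f) (hΓ : 0 < Γ)
    (h0 : ∫ x in cell Γ, f x = 0) :
    ∫ x in cell Γ, f x ^ 2 ≤
      (2 * Γ ^ 2 + 2) * ∫ x in cell Γ, (d₁ f x ^ 2 + d₂ f x ^ 2) := by
  set S := ∫ x in cell Γ, |d₂ f x| with hS
  have cB : Continuous fun x => ∫ y in (0 : ℝ)..1, |d₂ f (x, y)| :=
    continuous_integral_slice_snd hf.continuousOn_d₂.abs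
  have cB' : ContinuousOn (fun z : ℝ × ℝ => ∫ y in (0 : ℝ)..1, |d₂ f (z.1, y)|) strip :=
    (cB.comp continuous_fst).continuousOn
  have cD := continuousOn_integral_slice_fst (hf.continuousOn_d₁.fun_pow 2) 0 Γ
  have cD' : ContinuousOn (fun z : ℝ × ℝ => ∫ x in (0 : ℝ)..Γ, d₁ f (x, z.2) ^ 2) strip :=
    cD.comp continuousOn_snd fun z hz => hz.2
  have hIB : ∫ z in cell Γ, ∫ y in (0 : ℝ)..1, |d₂ f (z.1, y)| = S := by
    rw [integral_cell_eq_iterated cB' hΓ.le, hS,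
      integral_cell_eq_iterated hf.continuousOn_d₂.abs hΓ.le]
    simp
  have hID : ∫ z in cell Γ, ∫ x in (0 : ℝ)..Γ, d₁ f (x, z.2) ^ 2 =
      Γ * ∫ x in cell Γ, d₁ f x ^ 2 := by
    rw [integral_cell_eq_iterated_symm cD' hΓ.le,
      integral_cell_eq_iterated_symm (hf.continuousOn_d₁.fun_pow 2) hΓ.le]
    simp
  have hpt : ∀ z ∈ cell Γ, |f z| ≤ (∫ x in (0 : ℝ)..Γ, |d₁ f (x, z.2)|) + Γ⁻¹ * S := by
    rintro ⟨x, y⟩ ⟨hx, hy⟩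
    set A := ∫ x in (0 : ℝ)..Γ, |d₁ f (x, y)|
    have e1 : ∫ z in cell Γ, (f (x, y) - f z) = Γ * f (x, y) := by
      rw [integral_cell_sub continuousOn_const hf.continuousOn, h0, integral_cell_const hΓ.le,
        sub_zero]
    have e2 : |∫ z in cell Γ, (f (x, y) - f z)| ≤
        ∫ z in cell Γ, (A + ∫ y in (0 : ℝ)..1, |d₂ f (z.1, y)|) := by
      refine abs_integral_le_integral_abs.trans (setIntegral_mono_on
        (integrableOn_cell (continuousOn_const.sub hf.continuousOn).abs Γ)
        (integrableOn_cell (continuousOn_const.add cB') Γ) (measurableSet_cell Γ) ?_)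
      rintro ⟨x', y'⟩ ⟨hx', hy'⟩
      have h1 := hf.abs_sub_le_fst hy hx' hx
      have h2 := hf.abs_sub_le_snd x' hy' hy
      -- The path from `(x, y)` to `(x', y')` turns at `(x', y)`: the horizontal part depends on `y`
      -- only and the vertical part on `x'` only.
      exact (abs_sub_le _ (f (x', y)) _).trans (add_le_add h1 h2)
    rw [e1, integral_cell_add continuousOn_const cB', hIB, integral_cell_const hΓ.le, abs_mul,
      abs_of_pos hΓ] at e2
    rw [← mul_le_mul_iff_right₀ hΓ]
    refine e2.trans (le_of_eq ?_)
    field_simp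
  have hS2 : S ^ 2 ≤ Γ * ∫ x in cell Γ, d₂ f x ^ 2 := by
    have := sq_integral_cell_mul_le (f := fun _ => (1 : ℝ)) continuousOn_const
      hf.continuousOn_d₂.abs Γ
    simpa [measureReal_cell hΓ.le] using this
  have hpt2 : ∀ z ∈ cell Γ, f z ^ 2 ≤
      2 * Γ * (∫ x in (0 : ℝ)..Γ, d₁ f (x, z.2) ^ 2) + 2 * Γ⁻¹ ^ 2 * S ^ 2 := by
    intro z hz
    have h1 : (∫ x in (0 : ℝ)..Γ, |d₁ f (x, z.2)|) ^ 2 ≤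
        Γ * ∫ x in (0 : ℝ)..Γ, d₁ f (x, z.2) ^ 2 := by
      have c := continuous_slice_fst hf.continuousOn_d₁ hz.2
      simp only [intervalIntegral.integral_of_le hΓ.le]
      have := sq_integral_mul_le (μ := volume.restrict (Ioc 0 Γ)) (f := fun _ => (1 : ℝ))
        (g := fun x => |d₁ f (x, z.2)|) (by simp)
        ((c.abs.fun_pow 2).integrableOn_Ioc) ((continuous_const.mul c.abs).integrableOn_Ioc)
      simpa [hΓ.le] using this
    have h2 := pow_le_pow_left₀ (abs_nonneg _) (hpt z hz) 2
    rw [sq_abs] at h2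
    have h3 := add_sq_le (a := ∫ x in (0 : ℝ)..Γ, |d₁ f (x, z.2)|) (b := Γ⁻¹ * S)
    rw [mul_pow] at h3
    linarith
  calc ∫ x in cell Γ, f x ^ 2
      ≤ ∫ z in cell Γ, (2 * Γ * (∫ x in (0 : ℝ)..Γ, d₁ f (x, z.2) ^ 2)
          + 2 * Γ⁻¹ ^ 2 * S ^ 2) :=
        setIntegral_mono_on (integrableOn_cell (hf.continuousOn.fun_pow 2) Γ)
          (integrableOn_cell ((continuousOn_const.fun_mul cD').add continuousOn_const) Γ)
          (measurableSet_cell Γ) hpt2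
    _ = 2 * Γ ^ 2 * (∫ x in cell Γ, d₁ f x ^ 2) + 2 * Γ⁻¹ * S ^ 2 := by
        rw [integral_cell_add (continuousOn_const.fun_mul cD') continuousOn_const,
          integral_const_mul, hID, integral_cell_const hΓ.le]
        field_simp
    _ ≤ 2 * Γ ^ 2 * (∫ x in cell Γ, d₁ f x ^ 2) + 2 * ∫ x in cell Γ, d₂ f x ^ 2 := by
        have : Γ⁻¹ * S ^ 2 ≤ ∫ x in cell Γ, d₂ f x ^ 2 := (inv_mul_le_iff₀ hΓ).2 hS2
        linarith
    _ ≤ _ := by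
        rw [integral_cell_add (hf.continuousOn_d₁.fun_pow 2) (hf.continuousOn_d₂.fun_pow 2)]
        have h1 : 0 ≤ ∫ x in cell Γ, d₁ f x ^ 2 := integral_nonneg fun _ => sq_nonneg _
        have h2 : 0 ≤ ∫ x in cell Γ, d₂ f x ^ 2 := integral_nonneg fun _ => sq_nonneg _
        nlinarith [mul_nonneg (sq_nonneg Γ) h2]

theorem sq_h1Norm_le_of_integral_eq_zero (hf : PeriodicC1 Γ f) (hΓ : 0 < Γ)
    (h0 : ∫ x in cell Γ, f x = 0) :
    h1Norm Γ f ^ 2 ≤ (2 * Γ ^ 2 + 3) * ∫ x in cell Γ, (d₁ f x ^ 2 + d₂ f x ^ 2) := by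
  rw [sq_h1Norm]
  linarith [hf.integral_sq_le_of_integral_eq_zero hΓ h0]

end PeriodicC1

/-! ### Hölder's inequality on the cell. -/

theorem memLp_cell {f : ℝ × ℝ → ℝ} (hf : ContinuousOn f strip) (Γ : ℝ) (p : ℝ≥0∞) :
    MemLp f p (volume.restrict (cell Γ)) := by
  have hc := hf.mono (cell_subset_strip Γ)
  obtain ⟨B, hB⟩ := (isCompact_cell Γ).exists_bound_of_continuousOn hc
  have : IsFiniteMeasure (volume.restrict (cell Γ)) :=
    ⟨by simpa using volume_cell_lt_top Γ⟩
  exact MemLp.of_bound (hc.aestronglyMeasurable (measurableSet_cell Γ)) B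
    ((ae_restrict_mem (measurableSet_cell Γ)).mono hB)

theorem integral_cell_mul_le_rpow {p q : ℝ} (hpq : p.HolderConjugate q) {f g : ℝ × ℝ → ℝ}
    (hf : ContinuousOn f strip) (hg : ContinuousOn g strip) (hf0 : ∀ x, 0 ≤ f x)
    (hg0 : ∀ x, 0 ≤ g x) (Γ : ℝ) :
    ∫ x in cell Γ, f x * g x ≤
      (∫ x in cell Γ, f x ^ p) ^ (1 / p) * (∫ x in cell Γ, g x ^ q) ^ (1 / q) :=
  integral_mul_le_Lp_mul_Lq_of_nonneg hpq (ae_of_all _ hf0) (ae_of_all _ hg0)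
    (memLp_cell hf Γ _) (memLp_cell hg Γ _)

/-- Hölder against the constant `1` on a set of measure `Γ`. It reaches real exponents from the
integer powers that the inductive Sobolev bound provides. -/
theorem integral_cell_rpow_le_of_nat {Γ : ℝ} (hΓ : 0 ≤ Γ) {s : ℝ} (hs : 0 < s) {k : ℕ}
    (hk : s < k) {f : ℝ × ℝ → ℝ} (hf : ContinuousOn f strip) (hf0 : ∀ x, 0 ≤ f x) :
    ∫ x in cell Γ, f x ^ s ≤ (∫ x in cell Γ, f x ^ k) ^ (s / k) * Γ ^ (1 - s / k) := by
  have hk0 : (0 : ℝ) < k := hs.trans hk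
  have h1 : 1 < k / s := (one_lt_div hs).2 hk
  have hpq := Real.HolderConjugate.conjExponent h1
  have h := integral_cell_mul_le_rpow (f := fun x => f x ^ s) (g := fun _ => (1 : ℝ)) hpq
    (hf.rpow_const fun _ _ => Or.inr hs.le) continuousOn_const
    (fun x => Real.rpow_nonneg (hf0 x) s) (fun _ => zero_le_one) Γ
  have e1 : ∀ x, (f x ^ s) ^ ((k : ℝ) / s) = f x ^ k := fun x => by
    rw [← Real.rpow_mul (hf0 x), mul_div_cancel₀ _ hs.ne', Real.rpow_natCast]
  have e2 : 1 / Real.conjExponent (k / s) = 1 - s / k := by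
    have := hpq.inv_add_inv_eq_one
    rw [inv_div] at this
    rw [one_div]
    linarith
  simp only [e1, mul_one, Real.one_rpow, integral_cell_const hΓ, e2, one_div_div] at h
  exact h

/-! ### Solenoidal fields tangential to the walls. -/

section Solenoidal

variable {Γ : ℝ} {v₁ v₂ : ℝ × ℝ → ℝ}

theorem continuousOn_vorticity (h₁ : PeriodicC1 Γ v₁) (h₂ : PeriodicC1 Γ v₂) :
    ContinuousOn (vorticity v₁ v₂) strip :=
  h₂.continuousOn_d₁.sub h₁.continuousOn_d₂

/-- For a planar solenoidal field tangential to the walls, the `L²` norms of the gradient and of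
the vorticity agree. -/
theorem integral_sq_grad_eq_integral_sq_vorticity (h₁ : PeriodicC1 Γ v₁) (h₂ : PeriodicC1 Γ v₂)
    (hΓ : 0 ≤ Γ) (hdiv : ∀ x ∈ openStrip, d₁ v₁ x + d₂ v₂ x = 0) (htop : ∀ x, v₂ (x, 1) = 0)
    (hbot : ∀ x, v₂ (x, 0) = 0) :
    ∫ x in cell Γ, ((d₁ v₁ x ^ 2 + d₂ v₁ x ^ 2) + (d₁ v₂ x ^ 2 + d₂ v₂ x ^ 2)) =
      ∫ x in cell Γ, vorticity v₁ v₂ x ^ 2 := by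
  have hJ := h₂.integral_jacobian_eq_zero h₁ hΓ htop hbot
  have cJ : ContinuousOn (fun x => d₂ v₂ x * d₁ v₁ x - d₁ v₂ x * d₂ v₁ x) strip :=
    (h₂.continuousOn_d₂.mul h₁.continuousOn_d₁).sub (h₂.continuousOn_d₁.mul h₁.continuousOn_d₂)
  have e := integral_cell_sub (Γ := Γ) ((continuousOn_vorticity h₁ h₂).fun_pow 2)
    (continuousOn_const (c := (2 : ℝ)) |>.fun_mul cJ)
  rw [integral_const_mul, hJ, mul_zero, sub_zero] at e
  rw [← e]
  refine integral_cell_congr fun x hx => ?_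
  -- With zero divergence, `|∇v|²` equals `ω²` minus twice the Jacobian of `v₂` and `v₁` pointwise,
  -- and that Jacobian has zero integral.
  have := eq_neg_of_add_eq_zero_right (hdiv x hx)
  rw [vorticity, this]
  ring

/-- For a planar solenoidal field `v` tangential to the walls, `|v| |∇v|` is controlled in `L²`
by `|v| |ω|`. -/
theorem integral_sq_mul_sq_grad_le (h₁ : PeriodicC1 Γ v₁) (h₂ : PeriodicC1 Γ v₂)
    (hΓ : 0 ≤ Γ) (hdiv : ∀ x ∈ openStrip, d₁ v₁ x + d₂ v₂ x = 0) (htop : ∀ x, v₂ (x, 1) = 0)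
    (hbot : ∀ x, v₂ (x, 0) = 0) :
    ∫ x in cell Γ, (v₁ x ^ 2 + v₂ x ^ 2) *
        ((d₁ v₁ x ^ 2 + d₂ v₁ x ^ 2) + (d₁ v₂ x ^ 2 + d₂ v₂ x ^ 2)) ≤
      3 / 2 * ∫ x in cell Γ, (v₁ x ^ 2 + v₂ x ^ 2) * vorticity v₁ v₂ x ^ 2 := by
  have hg : PeriodicC1 Γ (fun x => v₁ x * v₁ x + v₂ x * v₂ x) := (h₁.mul h₁).add (h₂.mul h₂)
  have hp₁ := hg.mul h₁
  have hp₂ := hg.mul h₂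
  -- With `g = |v|²`, the Jacobians of `(g v₂, v₁)` and of `(v₂, g v₁)` both integrate to zero.
  -- Their sum is twice `g` times the Jacobian of `(v₂, v₁)`, as needed for `g|∇v|²`, plus terms in
  -- `∇g`.
  have hJ1 := hp₂.integral_jacobian_eq_zero h₁ hΓ (fun x => by simp [htop]) (fun x => by simp [hbot])
  have hJ2 := h₂.integral_jacobian_eq_zero hp₁ hΓ htop hbot
  have c1 := (hp₂.continuousOn_d₂.fun_mul h₁.continuousOn_d₁).fun_sub
    (hp₂.continuousOn_d₁.fun_mul h₁.continuousOn_d₂)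
  have c2 := (h₂.continuousOn_d₂.fun_mul hp₁.continuousOn_d₁).fun_sub
    (h₂.continuousOn_d₁.fun_mul hp₁.continuousOn_d₂)
  have cg : ContinuousOn (fun x => v₁ x ^ 2 + v₂ x ^ 2) strip :=
    (h₁.continuousOn.fun_pow 2).fun_add (h₂.continuousOn.fun_pow 2)
  have c3 := cg.fun_mul ((continuousOn_vorticity h₁ h₂).fun_pow 2)
  have c4 := continuousOn_const (c := (3 / 2 : ℝ)) |>.fun_mul c3
  have e := integral_cell_sub (Γ := Γ) c4 (c1.fun_add c2)
  rw [integral_cell_add c1 c2, hJ1, hJ2, integral_const_mul, add_zero, sub_zero] at e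
  rw [← e]
  refine integral_cell_mono (cg.mul (h₁.continuousOn_sq_grad.add h₂.continuousOn_sq_grad))
    (c4.sub (c1.add c2)) fun x hx => ?_
  have hxs := openStrip_subset_strip hx
  have hd := eq_neg_of_add_eq_zero_right (hdiv x hx)
  have g1 : d₁ (fun x => v₁ x * v₁ x + v₂ x * v₂ x) x = 2 * (v₁ x * d₁ v₁ x + v₂ x * d₁ v₂ x) := by
    rw [(h₁.mul h₁).d₁_add (h₂.mul h₂) hxs, h₁.d₁_mul h₁ hxs, h₂.d₁_mul h₂ hxs]
    ring
  have g2 : d₂ (fun x => v₁ x * v₁ x + v₂ x * v₂ x) x = 2 * (v₁ x * d₂ v₁ x + v₂ x * d₂ v₂ x) := by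
    rw [(h₁.mul h₁).d₂_add (h₂.mul h₂) hxs, h₁.d₂_mul h₁ hxs, h₂.d₂_mul h₂ hxs]
    ring
  rw [hg.d₁_mul h₁ hxs, hg.d₂_mul h₁ hxs, hg.d₁_mul h₂ hxs, hg.d₂_mul h₂ hxs, g1, g2, vorticity, hd]
  generalize v₁ x = p
  generalize v₂ x = q
  generalize d₁ v₁ x = a
  generalize d₂ v₁ x = b
  generalize d₁ v₂ x = c
  -- The `∇g` terms leave `-½(∂₁g - v₂ω)² - ½(∂₂g + v₁ω)² + ½gω²`. Dropping the squares gives the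
  -- constant `1 + 1/2`.
  have s1 := sq_nonneg (2 * (p * a + q * c) - (c - b) * q)
  have s2 := sq_nonneg (2 * (p * b - q * a) + (c - b) * p)
  nlinarith [s1, s2]

/-- Orthogonality to the gradient of `x₂`. Hence only the horizontal component has to be normalized
before Poincaré is used. -/
theorem integral_snd_eq_zero (h₁ : PeriodicC1 Γ v₁) (h₂ : PeriodicC1 Γ v₂)
    (hΓ : 0 ≤ Γ) (hdiv : ∀ x ∈ openStrip, d₁ v₁ x + d₂ v₂ x = 0) (htop : ∀ x, v₂ (x, 1) = 0)
    (hbot : ∀ x, v₂ (x, 0) = 0) : ∫ x in cell Γ, v₂ x = 0 := by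
  have hy : PeriodicC1 Γ (fun x => x.2) := PeriodicC1.of_snd contDiff_id
  rw [← hy.integral_grad_mul_eq_zero h₁ h₂ hΓ hdiv htop hbot]
  refine integral_cell_congr fun x hx => ?_
  have e1 : d₁ (fun x : ℝ × ℝ => x.2) x = 0 := by simp [d₁]
  have e2 : d₂ (fun x : ℝ × ℝ => x.2) x = 1 :=
    (hasDerivWithinAt_id x.2 _).derivWithin
      (uniqueDiffOn_Icc zero_lt_one _ (openStrip_subset_strip hx).2)
  rw [e1, e2]
  ring

/-- The convection term of a solenoidal field with zero mean, tangential to the walls, is bounded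
in `L²` by the vorticity. -/
theorem exists_integral_sq_mul_sq_grad_le_vorticity (hΓ : 0 < Γ) {r : ℝ} (hr : 2 < r) :
    ∃ C : ℝ, 0 ≤ C ∧ ∀ v₁ v₂ : ℝ × ℝ → ℝ, PeriodicC1 Γ v₁ → PeriodicC1 Γ v₂ →
      (∀ x ∈ openStrip, d₁ v₁ x + d₂ v₂ x = 0) → (∀ x, v₂ (x, 1) = 0) → (∀ x, v₂ (x, 0) = 0) →
      ∫ x in cell Γ, v₁ x = 0 →
      ∫ x in cell Γ, (v₁ x ^ 2 + v₂ x ^ 2) *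
          ((d₁ v₁ x ^ 2 + d₂ v₁ x ^ 2) + (d₁ v₂ x ^ 2 + d₂ v₂ x ^ 2)) ≤
        C * (∫ x in cell Γ, vorticity v₁ v₂ x ^ 2) *
          (∫ x in cell Γ, |vorticity v₁ v₂ x| ^ r) ^ (2 / r) := by
  have hr0 : 0 < r - 2 := by linarith
  -- The exponent conjugate to `r / 2`: Hölder puts `|v|²` in `Lˢ` and `ω²` in `L^{r/2}`. It is
  -- finite exactly because `r > 2`.
  set s : ℝ := r / (r - 2) with hs
  have hs0 : 0 < s := by positivity
  have hs1 : 1 < s := (one_lt_div hr0).2 (by linarith)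
  have hpq : s.HolderConjugate (r / 2) := by
    rw [Real.holderConjugate_iff]
    refine ⟨hs1, ?_⟩
    rw [hs, inv_div, inv_div, ← add_div]
    simp [show r ≠ 0 by linarith]
  obtain ⟨k, hk⟩ := exists_nat_gt s
  have hk0 : (0 : ℝ) < k := hs0.trans hk
  obtain ⟨C₁, hC₁0, hC₁⟩ := PeriodicC1.exists_integral_pow_le_h1Norm hΓ k
  set P : ℝ := 2 * Γ ^ 2 + 3 with hP
  have hP0 : 0 ≤ P := by positivity
  set C₂ : ℝ := 2 ^ (k - 1) * (2 * (C₁ * P ^ k)) with hC₂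
  have hC₂0 : 0 ≤ C₂ := by positivity
  set C₃ : ℝ := C₂ ^ (s / k) * Γ ^ (1 - s / k) with hC₃
  have hC₃0 : 0 ≤ C₃ := by positivity
  refine ⟨3 / 2 * C₃ ^ (1 / s), by positivity, fun v₁ v₂ h₁ h₂ hdiv htop hbot hmean => ?_⟩
  set N := ∫ x in cell Γ, vorticity v₁ v₂ x ^ 2 with hN
  have hN0 : 0 ≤ N := integral_nonneg fun _ => sq_nonneg _
  have hgrad := integral_sq_grad_eq_integral_sq_vorticity h₁ h₂ hΓ.le hdiv htop hbot
  rw [integral_cell_add h₁.continuousOn_sq_grad h₂.continuousOn_sq_grad] at hgrad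
  have hG1 : 0 ≤ ∫ x in cell Γ, (d₁ v₁ x ^ 2 + d₂ v₁ x ^ 2) := integral_nonneg fun _ => by positivity
  have hG2 : 0 ≤ ∫ x in cell Γ, (d₁ v₂ x ^ 2 + d₂ v₂ x ^ 2) := integral_nonneg fun _ => by positivity
  have hpow : ∀ v : ℝ × ℝ → ℝ, PeriodicC1 Γ v → ∫ x in cell Γ, v x = 0 →
      ∫ x in cell Γ, (d₁ v x ^ 2 + d₂ v x ^ 2) ≤ N →
      ∫ x in cell Γ, (v x ^ k) ^ 2 ≤ C₁ * P ^ k * N ^ k := fun v hv hv0 hle => by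
    have h3 : h1Norm Γ v ^ 2 ≤ P * N :=
      (hv.sq_h1Norm_le_of_integral_eq_zero hΓ hv0).trans (mul_le_mul_of_nonneg_left hle hP0)
    calc ∫ x in cell Γ, (v x ^ k) ^ 2 ≤ C₁ * (h1Norm Γ v ^ 2) ^ k := hC₁ v hv
      _ ≤ C₁ * (P * N) ^ k :=
        mul_le_mul_of_nonneg_left (pow_le_pow_left₀ (sq_nonneg _) h3 k) hC₁0
      _ = _ := by rw [mul_pow, mul_assoc]
  have q1 := hpow v₁ h₁ hmean (by linarith)
  have q2 := hpow v₂ h₂ (integral_snd_eq_zero h₁ h₂ hΓ.le hdiv htop hbot) (by linarith)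
  have cg : ContinuousOn (fun x => v₁ x ^ 2 + v₂ x ^ 2) strip :=
    (h₁.continuousOn.fun_pow 2).fun_add (h₂.continuousOn.fun_pow 2)
  have cω := (continuousOn_vorticity h₁ h₂).fun_pow 2
  have c1 := (h₁.continuousOn.fun_pow k).fun_pow 2
  have c2 := (h₂.continuousOn.fun_pow k).fun_pow 2
  have hgk : ∫ x in cell Γ, (v₁ x ^ 2 + v₂ x ^ 2) ^ k ≤ C₂ * N ^ k := by
    calc ∫ x in cell Γ, (v₁ x ^ 2 + v₂ x ^ 2) ^ k
        ≤ ∫ x in cell Γ, 2 ^ (k - 1) * ((v₁ x ^ k) ^ 2 + (v₂ x ^ k) ^ 2) := by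
          refine integral_cell_mono (cg.pow k) (continuousOn_const.mul (c1.add c2)) fun x _ => ?_
          rw [← pow_mul, ← pow_mul, mul_comm k, pow_mul, pow_mul]
          exact add_pow_le (sq_nonneg _) (sq_nonneg _) k
      _ = 2 ^ (k - 1) * ((∫ x in cell Γ, (v₁ x ^ k) ^ 2) + ∫ x in cell Γ, (v₂ x ^ k) ^ 2) := by
          rw [integral_const_mul, integral_cell_add c1 c2]
      _ ≤ 2 ^ (k - 1) * (C₁ * P ^ k * N ^ k + C₁ * P ^ k * N ^ k) := by gcongr
      _ = C₂ * N ^ k := by rw [hC₂]; ring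
  have hgs : (∫ x in cell Γ, (v₁ x ^ 2 + v₂ x ^ 2) ^ s) ^ (1 / s) ≤ C₃ ^ (1 / s) * N := by
    have h3 : ∫ x in cell Γ, (v₁ x ^ 2 + v₂ x ^ 2) ^ s ≤ C₃ * N ^ s := by
      calc _ ≤ (∫ x in cell Γ, (v₁ x ^ 2 + v₂ x ^ 2) ^ k) ^ (s / k) * Γ ^ (1 - s / k) :=
            integral_cell_rpow_le_of_nat hΓ.le hs0 hk cg fun _ => by positivity
        _ ≤ (C₂ * N ^ k) ^ (s / k) * Γ ^ (1 - s / k) := by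
            refine mul_le_mul_of_nonneg_right (Real.rpow_le_rpow
              (integral_nonneg fun _ => by positivity) hgk (by positivity)) (by positivity)
        _ = C₃ * N ^ s := by
            rw [Real.mul_rpow hC₂0 (by positivity), ← Real.rpow_natCast N k, ← Real.rpow_mul hN0,
              mul_div_cancel₀ _ hk0.ne', hC₃]
            ring
    calc _ ≤ (C₃ * N ^ s) ^ (1 / s) :=
          Real.rpow_le_rpow (integral_nonneg fun _ => by positivity) h3 (by positivity)
      _ = C₃ ^ (1 / s) * N := by
          rw [Real.mul_rpow hC₃0 (by positivity), ← Real.rpow_mul hN0, mul_one_div_cancel hs0.ne',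
            Real.rpow_one]
  have hH := integral_cell_mul_le_rpow hpq cg cω (fun _ => by positivity) (fun _ => sq_nonneg _) Γ
  have e : ∀ x, (vorticity v₁ v₂ x ^ 2) ^ (r / 2) = |vorticity v₁ v₂ x| ^ r := fun x => by
    rw [← sq_abs, ← Real.rpow_natCast, ← Real.rpow_mul (abs_nonneg _)]
    congr 1
    push_cast
    ring
  simp only [e, one_div_div] at hH
  have hR : 0 ≤ (∫ x in cell Γ, |vorticity v₁ v₂ x| ^ r) ^ (2 / r) :=
    Real.rpow_nonneg (integral_nonneg fun _ => by positivity) _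
  calc _ ≤ 3 / 2 * ∫ x in cell Γ, (v₁ x ^ 2 + v₂ x ^ 2) * vorticity v₁ v₂ x ^ 2 :=
        integral_sq_mul_sq_grad_le h₁ h₂ hΓ.le hdiv htop hbot
    _ ≤ 3 / 2 * (C₃ ^ (1 / s) * N * (∫ x in cell Γ, |vorticity v₁ v₂ x| ^ r) ^ (2 / r)) := by
        refine mul_le_mul_of_nonneg_left (hH.trans ?_) (by norm_num)
        exact mul_le_mul_of_nonneg_right hgs hR
    _ = _ := by ring

end Solenoidal

/-! ### Square-integral forms of the norms. -/

theorem lpNorm_two (Γ : ℝ) (f : ℝ × ℝ → ℝ) : lpNorm Γ 2 f = √(∫ x in cell Γ, f x ^ 2) := by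
  simp [lpNorm, Real.sqrt_eq_rpow]

theorem lpNormVec_two (Γ : ℝ) (f g : ℝ × ℝ → ℝ) :
    lpNormVec Γ 2 f g = √(∫ x in cell Γ, (f x ^ 2 + g x ^ 2)) := by
  have e : ∀ x, √(f x ^ 2 + g x ^ 2) ^ 2 = f x ^ 2 + g x ^ 2 :=
    fun x => Real.sq_sqrt (by positivity)
  simp only [lpNormVec, lpNorm_two, e]

theorem lpNorm_nonneg (Γ q : ℝ) (f : ℝ × ℝ → ℝ) : 0 ≤ lpNorm Γ q f :=
  Real.rpow_nonneg (integral_nonneg fun _ => by positivity) _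

theorem abs_mul_add_mul_le_sqrt (a b c d : ℝ) :
    |a * c + b * d| ≤ √(a ^ 2 + b ^ 2) * √(c ^ 2 + d ^ 2) := by
  rw [← Real.sqrt_mul (by positivity)]
  refine Real.abs_le_sqrt ?_
  nlinarith [sq_nonneg (a * d - b * c)]

theorem continuousOn_sqrt_sq_add_sq {f g : ℝ × ℝ → ℝ} (hf : ContinuousOn f strip)
    (hg : ContinuousOn g strip) : ContinuousOn (fun x => √(f x ^ 2 + g x ^ 2)) strip :=
  ((hf.fun_pow 2).fun_add (hg.fun_pow 2)).sqrt

theorem abs_integral_cell_inner_le {f₁ f₂ g₁ g₂ : ℝ × ℝ → ℝ} (hf₁ : ContinuousOn f₁ strip)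
    (hf₂ : ContinuousOn f₂ strip) (hg₁ : ContinuousOn g₁ strip) (hg₂ : ContinuousOn g₂ strip)
    (Γ : ℝ) :
    |∫ x in cell Γ, (f₁ x * g₁ x + f₂ x * g₂ x)| ≤
      √(∫ x in cell Γ, (f₁ x ^ 2 + f₂ x ^ 2)) * √(∫ x in cell Γ, (g₁ x ^ 2 + g₂ x ^ 2)) := by
  have cf := continuousOn_sqrt_sq_add_sq hf₁ hf₂
  have cg := continuousOn_sqrt_sq_add_sq hg₁ hg₂
  have h := abs_integral_cell_mul_le cf cg Γ
  have e : ∀ a b : ℝ, √(a ^ 2 + b ^ 2) ^ 2 = a ^ 2 + b ^ 2 := fun a b =>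
    Real.sq_sqrt (by positivity)
  simp only [e] at h
  refine abs_integral_le_integral_abs.trans (le_trans ?_ ((le_abs_self _).trans h))
  exact integral_cell_mono ((hf₁.mul hg₁).add (hf₂.mul hg₂)).abs (cf.mul cg)
    fun x _ => abs_mul_add_mul_le_sqrt _ _ _ _

/-! ### Differentiation in time under the integral. -/

section Time

variable {u : ℝ → ℝ × ℝ → ℝ}

theorem hasDerivAt_time (hu : ContDiffOn ℝ 1 (Function.uncurry u) (Ioi 0 ×ˢ strip)) {s : ℝ}
    (hs : 0 < s) {x : ℝ × ℝ} (hx : x ∈ strip) :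
    HasDerivAt (fun s => u s x)
      (fderivWithin ℝ (Function.uncurry u) (Ioi 0 ×ˢ strip) (s, x) (1, 0)) s := by
  have h1 := ((hu.differentiableOn (by norm_num)) (s, x) ⟨hs, hx⟩).hasFDerivWithinAt
  have h2 : HasDerivWithinAt (fun s : ℝ => (s, x)) ((1 : ℝ), (0 : ℝ × ℝ)) (Ioi 0) s :=
    (hasDerivWithinAt_id s _).prodMk (hasDerivWithinAt_const s _ x)
  exact (HasFDerivWithinAt.comp_hasDerivWithinAt (x := s) (f := fun s : ℝ => (s, x)) h1 h2
    (fun s hs => ⟨hs, hx⟩)).hasDerivAt (Ioi_mem_nhds hs)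

theorem continuousOn_time_deriv (hu : ContDiffOn ℝ 1 (Function.uncurry u) (Ioi 0 ×ˢ strip)) :
    ContinuousOn (fun z : ℝ × ℝ × ℝ => deriv (fun s => u s z.2) z.1) (Ioi 0 ×ˢ strip) := by
  have hU : UniqueDiffOn ℝ (Ioi (0 : ℝ) ×ˢ strip) := (uniqueDiffOn_Ioi 0).prod uniqueDiffOn_strip
  refine ((hu.continuousOn_fderivWithin hU (by norm_num)).clm_apply
    (continuousOn_const (c := ((1 : ℝ), (0 : ℝ × ℝ))))).congr ?_
  rintro ⟨s, x⟩ ⟨hs, hx⟩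
  exact (hasDerivAt_time hu hs hx).deriv

theorem hasDerivAt_integral_cell_time
    (hu : ContDiffOn ℝ 1 (Function.uncurry u) (Ioi 0 ×ˢ strip)) {φ : ℝ × ℝ → ℝ}
    (hφ : ContinuousOn φ strip) (Γ : ℝ) {t : ℝ} (ht : 0 < t) :
    HasDerivAt (fun s => ∫ x in cell Γ, φ x * u s x)
      (∫ x in cell Γ, φ x * deriv (fun s => u s x) t) t := by
  have hball : ∀ s ∈ Metric.ball t (t / 2), 0 < s ∧ s ∈ Icc (t / 2) (3 * t / 2) := fun s hs => by
    rw [Metric.mem_ball, Real.dist_eq, abs_lt] at hs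
    exact ⟨by linarith, by linarith, by linarith⟩
  have hslice : ∀ s, 0 < s → ContinuousOn (u s) strip := fun s hs =>
    hu.continuousOn.comp (f := fun x => (s, x)) (by fun_prop) fun x hx => ⟨hs, hx⟩
  have hslice' : ContinuousOn (fun x => deriv (fun s => u s x) t) strip :=
    (continuousOn_time_deriv hu).comp (f := fun x => (t, x)) (by fun_prop) fun x hx => ⟨ht, hx⟩
  obtain ⟨B, hB⟩ := (isCompact_cell Γ).exists_bound_of_continuousOn
    (hφ.mono (cell_subset_strip Γ))
  -- A compact time interval away from `0` gives a uniform bound for the time derivative, hence a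
  -- constant dominating function.
  obtain ⟨D, hD⟩ := ((isCompact_Icc (a := t / 2) (b := 3 * t / 2)).prod
    (isCompact_cell Γ)).exists_bound_of_continuousOn ((continuousOn_time_deriv hu).mono
      (prod_mono (fun s hs => lt_of_lt_of_le (half_pos ht) hs.1) (cell_subset_strip Γ)))
  refine (hasDerivAt_integral_of_dominated_loc_of_deriv_le
    (F' := fun s x => φ x * deriv (fun s => u s x) s)
    (bound := fun _ => B * D) (Metric.ball_mem_nhds t (half_pos ht)) ?_ ?_ ?_ ?_ ?_ ?_).2
  · filter_upwards [Metric.ball_mem_nhds t (half_pos ht)] with s hs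
    exact (integrableOn_cell (hφ.mul (hslice s (hball s hs).1)) Γ).aestronglyMeasurable
  · exact integrableOn_cell (hφ.mul (hslice t ht)) Γ
  · exact (integrableOn_cell (hφ.mul hslice') Γ).aestronglyMeasurable
  · filter_upwards [ae_restrict_mem (measurableSet_cell Γ)] with x hx s hs
    rw [norm_mul]
    exact mul_le_mul (hB x hx) (hD (s, x) ⟨(hball s hs).2, hx⟩) (norm_nonneg _)
      ((norm_nonneg _).trans (hB x hx))
  · exact integrableOn_cell continuousOn_const Γ
  · filter_upwards [ae_restrict_mem (measurableSet_cell Γ)] with x hx s hs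
    have h := hasDerivAt_time hu (hball s hs).1 (cell_subset_strip Γ hx)
    exact (h.differentiableAt.hasDerivAt).const_mul (φ x)

end Time

/-! ### The wall integral of part (ii). -/

/-- The boundary integral of `p ∂₁u₁` is controlled by the pressure and the vertical derivative
of the velocity. -/
theorem abs_integral_wall_le {Γ : ℝ} (hΓ : 0 < Γ) {u₁ u₂ p : ℝ × ℝ → ℝ} (h₁ : PeriodicC2 Γ u₁)
    (h₂ : PeriodicC1 Γ u₂) (hp : PeriodicC1 Γ p)
    (hdiv : ∀ x ∈ openStrip, d₁ u₁ x + d₂ u₂ x = 0) :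
    |∫ x₁ in (0 : ℝ)..Γ, (p (x₁, 1) * d₁ u₁ (x₁, 1) + p (x₁, 0) * d₁ u₁ (x₁, 0))| ≤
      3 * h1Norm Γ p * lpNormVec Γ 2 (d₂ u₁) (d₂ u₂) := by
  have hw : PeriodicC1 Γ (fun x => 2 * x.2 - 1) :=
    PeriodicC1.of_snd (w := fun y => 2 * y - 1) (by fun_prop)
  have w1 : ∀ x, d₁ (fun x : ℝ × ℝ => 2 * x.2 - 1) x = 0 := fun x => by simp [d₁]
  have w2 : ∀ x ∈ strip, d₂ (fun x : ℝ × ℝ => 2 * x.2 - 1) x = 2 := fun x hx => by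
    have h : HasDerivAt (fun s : ℝ => 2 * s - 1) (2 * 1) x.2 :=
      ((hasDerivAt_id x.2).const_mul 2).sub_const 1
    rw [mul_one] at h
    exact h.hasDerivWithinAt.derivWithin (uniqueDiffOn_Icc zero_lt_one _ hx.2)
  have hH := hw.mul (hp.mul h₁.d₁)
  have hK := hw.mul (hp.mul h₁.d₂)
  have i1 : Continuous fun x => p (x, 1) * d₁ u₁ (x, 1) :=
    continuous_slice_fst (hp.mul h₁.d₁).continuousOn (by simp)
  have i0 : Continuous fun x => p (x, 0) * d₁ u₁ (x, 0) :=
    continuous_slice_fst (hp.mul h₁.d₁).continuousOn (by simp)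
  have e1 := hH.integral_d₂ hΓ.le
  have e2 := integral_cell_sub (Γ := Γ) hH.continuousOn_d₂ hK.continuousOn_d₁
  rw [hK.integral_d₁ hΓ.le, sub_zero, e1] at e2
  have e3 : ∫ x₁ in (0 : ℝ)..Γ, (p (x₁, 1) * d₁ u₁ (x₁, 1) + p (x₁, 0) * d₁ u₁ (x₁, 0)) =
      ∫ x in cell Γ, (d₂ (fun x => (2 * x.2 - 1) * (p x * d₁ u₁ x)) x
        - d₁ (fun x => (2 * x.2 - 1) * (p x * d₂ u₁ x)) x) := by
    rw [e2, intervalIntegral.integral_add (i1.intervalIntegrable _ _) (i0.intervalIntegrable _ _)]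
    norm_num
  have cn := continuousOn_sqrt_sq_add_sq hp.continuousOn_d₁ hp.continuousOn_d₂
  have ce := continuousOn_sqrt_sq_add_sq h₁.periodicC1.continuousOn_d₂ h₂.continuousOn_d₂
  have ca : ContinuousOn (fun x => 2 * |p x| + √(d₁ p x ^ 2 + d₂ p x ^ 2)) strip :=
    (continuousOn_const.mul hp.continuousOn.abs).add cn
  have hle : |∫ x in cell Γ, (d₂ (fun x => (2 * x.2 - 1) * (p x * d₁ u₁ x)) x
        - d₁ (fun x => (2 * x.2 - 1) * (p x * d₂ u₁ x)) x)| ≤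
      ∫ x in cell Γ, (2 * |p x| + √(d₁ p x ^ 2 + d₂ p x ^ 2)) *
        √(d₂ u₁ x ^ 2 + d₂ u₂ x ^ 2) := by
    refine abs_integral_le_integral_abs.trans (integral_cell_mono
      (hH.continuousOn_d₂.sub hK.continuousOn_d₁).abs (ca.mul ce) fun x hx => ?_)
    have hxs := openStrip_subset_strip hx
    have hd := eq_neg_of_add_eq_zero_left (hdiv x hx)
    rw [hw.d₂_mul (hp.mul h₁.d₁) hxs, hw.d₁_mul (hp.mul h₁.d₂) hxs, hp.d₂_mul h₁.d₁ hxs,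
      hp.d₁_mul h₁.d₂ hxs, d₁_d₂_comm h₁.contDiffOn hx, w1, w2 x hxs, hd]
    -- The subtracted horizontal derivative integrates to zero by periodicity and is there to cancel
    -- the mixed second derivative. With `∂₁u₁ = -∂₂u₂`, only `∂₂u` remains.
    have e : 2 * (p x * -d₂ u₂ x) + (2 * x.2 - 1) * (d₂ p x * -d₂ u₂ x + p x * d₂ (d₁ u₁) x) -
        (0 * (p x * d₂ u₁ x) + (2 * x.2 - 1) * (d₁ p x * d₂ u₁ x + p x * d₂ (d₁ u₁) x)) =
        -(2 * p x * d₂ u₂ x + (2 * x.2 - 1) * (d₁ p x * d₂ u₁ x + d₂ p x * d₂ u₂ x)) := by ring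
    rw [e, abs_neg, add_mul]
    refine (abs_add_le _ _).trans (add_le_add ?_ ?_)
    · rw [abs_mul, abs_mul, abs_two]
      refine mul_le_mul_of_nonneg_left (Real.abs_le_sqrt ?_) (by positivity)
      nlinarith [sq_nonneg (d₂ u₁ x)]
    · rw [abs_mul]
      refine (mul_le_of_le_one_left (abs_nonneg _) ?_).trans (abs_mul_add_mul_le_sqrt _ _ _ _)
      rw [abs_le]
      constructor <;> linarith [hx.2.1, hx.2.2]
  have hCS := (le_abs_self _).trans (abs_integral_cell_mul_le ca ce Γ)
  have esq : ∀ a b : ℝ, √(a ^ 2 + b ^ 2) ^ 2 = a ^ 2 + b ^ 2 := fun a b =>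
    Real.sq_sqrt (by positivity)
  rw [e3, lpNormVec_two]
  refine hle.trans (hCS.trans ?_)
  simp only [esq]
  refine mul_le_mul_of_nonneg_right ?_ (Real.sqrt_nonneg _)
  refine Real.sqrt_le_iff.2 ⟨mul_nonneg (by norm_num) (Real.sqrt_nonneg _), ?_⟩
  rw [mul_pow, PeriodicC1.sq_h1Norm, ← integral_cell_add (hp.continuousOn.fun_pow 2)
    hp.continuousOn_sq_grad, ← integral_const_mul]
  refine integral_cell_mono (ca.pow 2) (continuousOn_const.mul ((hp.continuousOn.fun_pow 2).add
    hp.continuousOn_sq_grad)) fun x _ => ?_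
  -- `(2a + b)² + (a - 2b)² = 5(a² + b²)`, and `5 ≤ 3²`.
  nlinarith [sq_nonneg (|p x| - 2 * √(d₁ p x ^ 2 + d₂ p x ^ 2)), esq (d₁ p x) (d₂ p x),
    sq_abs (p x), sq_nonneg (p x), sq_nonneg (d₁ p x), sq_nonneg (d₂ p x)]

/-! ### The pressure balance for solutions. -/

namespace IsSolution

variable {Γ Ra Pr : ℝ} {Ls : ℝ≥0∞} {u₁ u₂ p T : ℝ → ℝ × ℝ → ℝ}

theorem periodicC2_fst (h : IsSolution Γ Ra Pr Ls u₁ u₂ p T) {t : ℝ} (ht : 0 < t) :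
    PeriodicC2 Γ (u₁ t) := ⟨h.u₁_c2 t ht, h.u₁_periodic t ht⟩

theorem periodicC2_snd (h : IsSolution Γ Ra Pr Ls u₁ u₂ p T) {t : ℝ} (ht : 0 < t) :
    PeriodicC2 Γ (u₂ t) := ⟨h.u₂_c2 t ht, h.u₂_periodic t ht⟩

theorem periodicC1_pressure (h : IsSolution Γ Ra Pr Ls u₁ u₂ p T) {t : ℝ} (ht : 0 < t) :
    PeriodicC1 Γ (p t) := ⟨h.p_c1 t ht, h.p_periodic t ht⟩

theorem continuousOn_temperature (h : IsSolution Γ Ra Pr Ls u₁ u₂ p T) {t : ℝ} (ht : 0 < t) :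
    ContinuousOn (T t) strip :=
  h.T_cont.comp (f := fun x => (t, x)) (by fun_prop) fun _ hx => ⟨ht, hx⟩

theorem periodicC1_vorticity (h : IsSolution Γ Ra Pr Ls u₁ u₂ p T) {t : ℝ} (ht : 0 < t) :
    PeriodicC1 Γ (vorticity (u₁ t) (u₂ t)) := (h.periodicC2_snd ht).d₁.sub (h.periodicC2_fst ht).d₂

theorem div_eq_zero (h : IsSolution Γ Ra Pr Ls u₁ u₂ p T) {t : ℝ} (ht : 0 < t) {x : ℝ × ℝ}
    (hx : x ∈ strip) : d₁ (u₁ t) x + d₂ (u₂ t) x = 0 :=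
  Set.EqOn.of_subset_closure (f := fun x => d₁ (u₁ t) x + d₂ (u₂ t) x) (g := fun _ => 0)
    (fun x hx => h.incompressible t ht x hx)
    ((h.periodicC2_fst ht).d₁.continuousOn.add (h.periodicC2_snd ht).d₂.continuousOn)
    continuousOn_const openStrip_subset_strip strip_subset_closure_openStrip hx

theorem d₁_div_eq_zero (h : IsSolution Γ Ra Pr Ls u₁ u₂ p T) {t : ℝ} (ht : 0 < t) {x : ℝ × ℝ}
    (hx : x ∈ strip) : d₁ (d₁ (u₁ t)) x + d₁ (d₂ (u₂ t)) x = 0 := by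
  rw [← (h.periodicC2_fst ht).d₁.d₁_add (h.periodicC2_snd ht).d₂ hx, d₁]
  simp only [h.div_eq_zero ht (mk_mem_strip hx.2), deriv_const]

theorem d₂_div_eq_zero (h : IsSolution Γ Ra Pr Ls u₁ u₂ p T) {t : ℝ} (ht : 0 < t) {x : ℝ × ℝ}
    (hx : x ∈ strip) : d₂ (d₁ (u₁ t)) x + d₂ (d₂ (u₂ t)) x = 0 := by
  rw [← (h.periodicC2_fst ht).d₁.d₂_add (h.periodicC2_snd ht).d₂ hx, d₂,
    derivWithin_congr (f := fun _ => (0 : ℝ)) (fun s hs => h.div_eq_zero ht (mk_mem_strip hs))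
      (h.div_eq_zero ht (mk_mem_strip hx.2))]
  simp

theorem laplacian_fst (h : IsSolution Γ Ra Pr Ls u₁ u₂ p T) {t : ℝ} (ht : 0 < t) {x : ℝ × ℝ}
    (hx : x ∈ openStrip) : laplacian (u₁ t) x = -d₂ (vorticity (u₁ t) (u₂ t)) x := by
  have hxs := openStrip_subset_strip hx
  have e : d₂ (vorticity (u₁ t) (u₂ t)) x = d₂ (d₁ (u₂ t)) x - d₂ (d₂ (u₁ t)) x :=
    (h.periodicC2_snd ht).d₁.d₂_sub (h.periodicC2_fst ht).d₂ hxs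
  rw [e, laplacian, ← d₁_d₂_comm (h.u₂_c2 t ht) hx]
  linear_combination h.d₁_div_eq_zero ht hxs

theorem laplacian_snd (h : IsSolution Γ Ra Pr Ls u₁ u₂ p T) {t : ℝ} (ht : 0 < t) {x : ℝ × ℝ}
    (hx : x ∈ openStrip) : laplacian (u₂ t) x = d₁ (vorticity (u₁ t) (u₂ t)) x := by
  have hxs := openStrip_subset_strip hx
  have e : d₁ (vorticity (u₁ t) (u₂ t)) x = d₁ (d₁ (u₂ t)) x - d₁ (d₂ (u₁ t)) x :=
    (h.periodicC2_snd ht).d₁.d₁_sub (h.periodicC2_fst ht).d₂ hxs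
  rw [e, laplacian, d₁_d₂_comm (h.u₁_c2 t ht) hx]
  linear_combination h.d₂_div_eq_zero ht hxs

/-- With `φ` fixed in time, `∫ ∇φ · u` vanishes at all positive times, so its time derivative does
too. This avoids differentiating the divergence or the wall conditions of `u` in time. -/
theorem integral_grad_mul_time_deriv (h : IsSolution Γ Ra Pr Ls u₁ u₂ p T) (hΓ : 0 ≤ Γ) {t : ℝ}
    (ht : 0 < t) {φ : ℝ × ℝ → ℝ} (hφ : PeriodicC1 Γ φ) :
    ∫ x in cell Γ, (d₁ φ x * deriv (fun s => u₁ s x) t + d₂ φ x * deriv (fun s => u₂ s x) t)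
      = 0 := by
  have c1 : ContinuousOn (fun x => deriv (fun s => u₁ s x) t) strip :=
    (continuousOn_time_deriv h.u₁_c1).comp (f := fun x => (t, x)) (by fun_prop)
      fun x hx => ⟨ht, hx⟩
  have c2 : ContinuousOn (fun x => deriv (fun s => u₂ s x) t) strip :=
    (continuousOn_time_deriv h.u₂_c1).comp (f := fun x => (t, x)) (by fun_prop)
      fun x hx => ⟨ht, hx⟩
  have hd := (hasDerivAt_integral_cell_time h.u₁_c1 hφ.continuousOn_d₁ Γ ht).add
    (hasDerivAt_integral_cell_time h.u₂_c1 hφ.continuousOn_d₂ Γ ht)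
  rw [integral_cell_add (hφ.continuousOn_d₁.fun_mul c1) (hφ.continuousOn_d₂.fun_mul c2)]
  refine hd.unique ((hasDerivAt_const t (0 : ℝ)).congr_of_eventuallyEq ?_)
  filter_upwards [Ioi_mem_nhds ht] with s hs
  have h1 := (h.periodicC2_fst hs).periodicC1
  have h2 := (h.periodicC2_snd hs).periodicC1
  rw [Pi.add_apply, ← integral_cell_add (hφ.continuousOn_d₁.fun_mul h1.continuousOn)
    (hφ.continuousOn_d₂.fun_mul h2.continuousOn)]
  exact hφ.integral_grad_mul_eq_zero h1 h2 hΓ (h.incompressible s hs) (h.u₂_top s hs)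
    (h.u₂_bottom s hs)

/-- `∂₁u` inherits zero divergence and tangency from `u`. This is what permits subtracting a
constant from `u₁` in the convection term. -/
theorem integral_grad_mul_d₁ (h : IsSolution Γ Ra Pr Ls u₁ u₂ p T) (hΓ : 0 ≤ Γ) {t : ℝ}
    (ht : 0 < t) {φ : ℝ × ℝ → ℝ} (hφ : PeriodicC1 Γ φ) :
    ∫ x in cell Γ, (d₁ φ x * d₁ (u₁ t) x + d₂ φ x * d₁ (u₂ t) x) = 0 := by
  refine hφ.integral_grad_mul_eq_zero (h.periodicC2_fst ht).d₁ (h.periodicC2_snd ht).d₁ hΓ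
    (fun x hx => ?_) (fun x => ?_) fun x => ?_
  · rw [← d₁_d₂_comm (h.u₂_c2 t ht) hx]
    exact h.d₁_div_eq_zero ht (openStrip_subset_strip hx)
  · simp [d₁, h.u₂_top t ht]
  · simp [d₁, h.u₂_bottom t ht]

/-- On the wall `∂₁u₂ = 0`, so `ω = -∂₂u₁` and the slip condition may be differentiated along the
wall. -/
theorem d₁_vorticity_top (h : IsSolution Γ Ra Pr Ls u₁ u₂ p T) {t : ℝ} (ht : 0 < t) (x : ℝ) :
    d₁ (vorticity (u₁ t) (u₂ t)) (x, 1) = Ls⁻¹.toReal * d₁ (u₁ t) (x, 1) := by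
  have e : ∀ s, vorticity (u₁ t) (u₂ t) (s, 1) = Ls⁻¹.toReal * u₁ t (s, 1) := fun s => by
    rw [vorticity, h.slip_top t ht, d₁]
    simp [h.u₂_top t ht]
  rw [d₁, d₁]
  simp only [e, deriv_const_mul_field']

theorem d₁_vorticity_bottom (h : IsSolution Γ Ra Pr Ls u₁ u₂ p T) {t : ℝ} (ht : 0 < t) (x : ℝ) :
    d₁ (vorticity (u₁ t) (u₂ t)) (x, 0) = -Ls⁻¹.toReal * d₁ (u₁ t) (x, 0) := by
  have e : ∀ s, vorticity (u₁ t) (u₂ t) (s, 0) = -Ls⁻¹.toReal * u₁ t (s, 0) := fun s => by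
    rw [vorticity, h.slip_bottom t ht, d₁]
    simp [h.u₂_bottom t ht]
  rw [d₁, d₁]
  simp only [e, deriv_const_mul_field']

/-- The viscous part of the pressure balance reduces to a wall term. -/
theorem integral_grad_pressure_mul_curl_vorticity (h : IsSolution Γ Ra Pr Ls u₁ u₂ p T)
    (hΓ : 0 ≤ Γ) {t : ℝ} (ht : 0 < t) :
    ∫ x in cell Γ, (d₂ (p t) x * d₁ (vorticity (u₁ t) (u₂ t)) x
        - d₁ (p t) x * d₂ (vorticity (u₁ t) (u₂ t)) x) =
      Ls⁻¹.toReal * ∫ x₁ in (0 : ℝ)..Γ,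
        (p t (x₁, 1) * d₁ (u₁ t) (x₁, 1) + p t (x₁, 0) * d₁ (u₁ t) (x₁, 0)) := by
  have hp := h.periodicC1_pressure ht
  have hpu := hp.mul (h.periodicC2_fst ht).d₁
  have i1 : Continuous fun x => p t (x, 1) * d₁ (u₁ t) (x, 1) :=
    continuous_slice_fst hpu.continuousOn (by simp)
  have i0 : Continuous fun x => p t (x, 0) * d₁ (u₁ t) (x, 0) :=
    continuous_slice_fst hpu.continuousOn (by simp)
  rw [hp.integral_jacobian (h.periodicC1_vorticity ht) hΓ,
    intervalIntegral.integral_add (i1.intervalIntegrable _ _) (i0.intervalIntegrable _ _)]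
  simp only [h.d₁_vorticity_top ht, h.d₁_vorticity_bottom ht, mul_left_comm (p t _),
    intervalIntegral.integral_const_mul]
  ring

/-- The energy identity for the pressure, with the velocity in a horizontally moving frame. -/
theorem integral_sq_grad_pressure (h : IsSolution Γ Ra Pr Ls u₁ u₂ p T) (hΓ : 0 ≤ Γ) {t : ℝ}
    (ht : 0 < t) (c : ℝ) :
    ∫ x in cell Γ, (d₁ (p t) x ^ 2 + d₂ (p t) x ^ 2) =
      Ls⁻¹.toReal * (∫ x₁ in (0 : ℝ)..Γ,
        (p t (x₁, 1) * d₁ (u₁ t) (x₁, 1) + p t (x₁, 0) * d₁ (u₁ t) (x₁, 0)))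
      - 1 / Pr * (∫ x in cell Γ,
        (d₁ (p t) x * ((u₁ t x - c) * d₁ (u₁ t) x + u₂ t x * d₂ (u₁ t) x)
          + d₂ (p t) x * ((u₁ t x - c) * d₁ (u₂ t) x + u₂ t x * d₂ (u₂ t) x)))
      + Ra * ∫ x in cell Γ, d₂ (p t) x * T t x := by
  have h1 := (h.periodicC2_fst ht).periodicC1
  have h2 := (h.periodicC2_snd ht).periodicC1
  have hp := h.periodicC1_pressure ht
  have hω := h.periodicC1_vorticity ht
  have hT := h.continuousOn_temperature ht
  have t1 : ContinuousOn (fun x => deriv (fun s => u₁ s x) t) strip :=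
    (continuousOn_time_deriv h.u₁_c1).comp (f := fun x => (t, x)) (by fun_prop)
      fun x hx => ⟨ht, hx⟩
  have t2 : ContinuousOn (fun x => deriv (fun s => u₂ s x) t) strip :=
    (continuousOn_time_deriv h.u₂_c1).comp (f := fun x => (t, x)) (by fun_prop)
      fun x hx => ⟨ht, hx⟩
  have cA := (hp.continuousOn_d₂.fun_mul hω.continuousOn_d₁).fun_sub
    (hp.continuousOn_d₁.fun_mul hω.continuousOn_d₂)
  have cB := (hp.continuousOn_d₁.fun_mul t1).fun_add (hp.continuousOn_d₂.fun_mul t2)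
  have cC := (hp.continuousOn_d₁.fun_mul h1.continuousOn_d₁).fun_add
    (hp.continuousOn_d₂.fun_mul h2.continuousOn_d₁)
  have hv := (h1.sub_const c).continuousOn
  have cD := (hp.continuousOn_d₁.fun_mul ((hv.fun_mul h1.continuousOn_d₁).fun_add
    (h2.continuousOn.fun_mul h1.continuousOn_d₂))).fun_add (hp.continuousOn_d₂.fun_mul
      ((hv.fun_mul h2.continuousOn_d₁).fun_add (h2.continuousOn.fun_mul h2.continuousOn_d₂)))
  have cE := hp.continuousOn_d₂.fun_mul hT
  have cst := fun a : ℝ => (continuousOn_const (c := a) : ContinuousOn (fun _ : ℝ × ℝ => a) strip)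
  have e : ∀ x ∈ openStrip, d₁ (p t) x ^ 2 + d₂ (p t) x ^ 2 =
      (d₂ (p t) x * d₁ (vorticity (u₁ t) (u₂ t)) x
        - d₁ (p t) x * d₂ (vorticity (u₁ t) (u₂ t)) x)
      - 1 / Pr * (d₁ (p t) x * deriv (fun s => u₁ s x) t + d₂ (p t) x * deriv (fun s => u₂ s x) t)
      - 1 / Pr * c * (d₁ (p t) x * d₁ (u₁ t) x + d₂ (p t) x * d₁ (u₂ t) x)
      - 1 / Pr * (d₁ (p t) x * ((u₁ t x - c) * d₁ (u₁ t) x + u₂ t x * d₂ (u₁ t) x)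
          + d₂ (p t) x * ((u₁ t x - c) * d₁ (u₂ t) x + u₂ t x * d₂ (u₂ t) x))
      + Ra * (d₂ (p t) x * T t x) := fun x hx => by
    have m1 := h.momentum₁ t ht x hx
    have m2 := h.momentum₂ t ht x hx
    rw [h.laplacian_fst ht hx] at m1
    rw [h.laplacian_snd ht hx] at m2
    linear_combination d₁ (p t) x * m1 + d₂ (p t) x * m2
  rw [integral_cell_congr e, integral_cell_add ((((cA.fun_sub ((cst _).fun_mul cB)).fun_sub
      ((cst _).fun_mul cC)).fun_sub ((cst _).fun_mul cD))) ((cst _).fun_mul cE),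
    integral_cell_sub (((cA.fun_sub ((cst _).fun_mul cB)).fun_sub ((cst _).fun_mul cC)))
      ((cst _).fun_mul cD),
    integral_cell_sub (cA.fun_sub ((cst _).fun_mul cB)) ((cst _).fun_mul cC),
    integral_cell_sub cA ((cst _).fun_mul cB), integral_const_mul, integral_const_mul,
    integral_const_mul, integral_const_mul, h.integral_grad_mul_time_deriv hΓ ht hp,
    h.integral_grad_mul_d₁ hΓ ht hp, h.integral_grad_pressure_mul_curl_vorticity hΓ ht]
  ring

/-! ### The pressure bound of part (i). -/

theorem exists_h1Norm_pressure_le (hΓ : 0 < Γ) {r : ℝ} (hr : 2 < r) : ∃ C : ℝ, 0 < C ∧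
    ∀ (Ra Pr : ℝ) (Ls : ℝ≥0∞), 0 < Ra → 0 < Pr →
    ∀ u₁ u₂ p T : ℝ → ℝ × ℝ → ℝ, IsSolution Γ Ra Pr Ls u₁ u₂ p T →
    ∀ t : ℝ, 0 < t → (∫ x in cell Γ, p t x) = 0 →
      h1Norm Γ (p t) ≤ C * (Ls⁻¹.toReal * lpNormVec Γ 2 (d₂ (u₁ t)) (d₂ (u₂ t))
        + 1 / Pr * lpNorm Γ 2 (vorticity (u₁ t) (u₂ t)) * lpNorm Γ r (vorticity (u₁ t) (u₂ t))
        + Ra * lpNorm Γ 2 (T t)) := by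
  obtain ⟨K, hK0, hK⟩ := exists_integral_sq_mul_sq_grad_le_vorticity hΓ hr
  -- `2Γ² + 3` is the Poincaré constant; `3 + √K` dominates the coefficients `3` (wall), `√K`
  -- (convection) and `1` (buoyancy).
  refine ⟨(2 * Γ ^ 2 + 3) * (3 + √K), by positivity,
    fun Ra Pr Ls hRa hPr u₁ u₂ p T h t ht hmean => ?_⟩
  have h1 := (h.periodicC2_fst ht).periodicC1
  have h2 := (h.periodicC2_snd ht).periodicC1
  have hp := h.periodicC1_pressure ht
  have hT := h.continuousOn_temperature ht
  -- The mean of `u₁`, which the vorticity does not see; the cell has area `Γ`.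
  set c : ℝ := Γ⁻¹ * ∫ x in cell Γ, u₁ t x with hc
  have hv : PeriodicC1 Γ (fun x => u₁ t x - c) := h1.sub_const c
  have hv0 : ∫ x in cell Γ, (u₁ t x - c) = 0 := by
    rw [integral_cell_sub h1.continuousOn continuousOn_const, integral_cell_const hΓ.le, hc,
      mul_inv_cancel_left₀ hΓ.ne', sub_self]
  have hconv := hK _ _ hv h2 (by rw [d₁_sub_const]; exact h.incompressible t ht)
    (h.u₂_top t ht) (h.u₂_bottom t ht) hv0
  have eω : vorticity (fun x => u₁ t x - c) (u₂ t) = vorticity (u₁ t) (u₂ t) := by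
    funext x
    rw [vorticity, d₂_sub_const, vorticity]
  rw [eω, d₁_sub_const, d₂_sub_const] at hconv
  set X := lpNormVec Γ 2 (d₂ (u₁ t)) (d₂ (u₂ t)) with hX
  set W := lpNorm Γ 2 (vorticity (u₁ t) (u₂ t)) with hW
  set R := lpNorm Γ r (vorticity (u₁ t) (u₂ t)) with hR
  set Z := lpNorm Γ 2 (T t) with hZ
  set H := h1Norm Γ (p t) with hH
  set G := ∫ x in cell Γ, (d₁ (p t) x ^ 2 + d₂ (p t) x ^ 2) with hG
  have hX0 : 0 ≤ X := lpNorm_nonneg _ _ _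
  have hW0 : 0 ≤ W := lpNorm_nonneg _ _ _
  have hR0 : 0 ≤ R := lpNorm_nonneg _ _ _
  have hZ0 : 0 ≤ Z := lpNorm_nonneg _ _ _
  have hH0 : 0 ≤ H := Real.sqrt_nonneg _
  have hL0 : 0 ≤ Ls⁻¹.toReal := ENNReal.toReal_nonneg
  have hPr0 : 0 < 1 / Pr := by positivity
  have hGH : √G ≤ H := Real.sqrt_le_sqrt (le_add_of_nonneg_left
    (integral_nonneg fun _ => sq_nonneg _))
  have hwall := abs_integral_wall_le hΓ (h.periodicC2_fst ht) h2 hp (h.incompressible t ht)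
  have cA := (hv.continuousOn.fun_mul h1.continuousOn_d₁).fun_add
    (h2.continuousOn.fun_mul h1.continuousOn_d₂)
  have cB := (hv.continuousOn.fun_mul h2.continuousOn_d₁).fun_add
    (h2.continuousOn.fun_mul h2.continuousOn_d₂)
  have hN := abs_integral_cell_inner_le hp.continuousOn_d₁ hp.continuousOn_d₂ cA cB Γ
  have hN2 : √(∫ x in cell Γ, (((u₁ t x - c) * d₁ (u₁ t) x + u₂ t x * d₂ (u₁ t) x) ^ 2
      + ((u₁ t x - c) * d₁ (u₂ t) x + u₂ t x * d₂ (u₂ t) x) ^ 2)) ≤ √K * (W * R) := by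
    refine Real.sqrt_le_iff.2 ⟨by positivity, ?_⟩
    have eW : W ^ 2 = ∫ x in cell Γ, vorticity (u₁ t) (u₂ t) x ^ 2 := by
      rw [hW, lpNorm_two, Real.sq_sqrt (integral_nonneg fun _ => sq_nonneg _)]
    have eR : R ^ 2 = (∫ x in cell Γ, |vorticity (u₁ t) (u₂ t) x| ^ r) ^ (2 / r) := by
      rw [hR, lpNorm, ← Real.rpow_natCast, ← Real.rpow_mul (integral_nonneg fun _ => by positivity)]
      congr 1
      push_cast
      ring
    rw [mul_pow, Real.sq_sqrt hK0, mul_pow, eW, eR, ← mul_assoc]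
    refine le_trans (integral_cell_mono ((cA.pow 2).add (cB.pow 2))
      (((hv.continuousOn.fun_pow 2).fun_add (h2.continuousOn.fun_pow 2)).fun_mul
        (h1.continuousOn_sq_grad.fun_add h2.continuousOn_sq_grad)) fun x _ => ?_) hconv
    nlinarith [sq_nonneg ((u₁ t x - c) * d₂ (u₁ t) x - u₂ t x * d₁ (u₁ t) x),
      sq_nonneg ((u₁ t x - c) * d₂ (u₂ t) x - u₂ t x * d₁ (u₂ t) x)]
  have hB := abs_integral_cell_mul_le hp.continuousOn_d₂ hT Γ
  have hB2 : √(∫ x in cell Γ, d₂ (p t) x ^ 2) ≤ √G :=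
    Real.sqrt_le_sqrt (integral_cell_mono (hp.continuousOn_d₂.fun_pow 2) hp.continuousOn_sq_grad
      fun x _ => le_add_of_nonneg_left (sq_nonneg _))
  rw [← lpNorm_two Γ (T t)] at hB
  have hid := h.integral_sq_grad_pressure hΓ.le ht c
  rw [← hG] at hid
  have b1 := mul_le_mul_of_nonneg_left ((le_abs_self _).trans hwall) hL0
  have b2 := mul_le_mul_of_nonneg_left ((neg_le_abs _).trans (hN.trans
    (mul_le_mul hGH hN2 (Real.sqrt_nonneg _) hH0))) hPr0.le
  have b3 := mul_le_mul_of_nonneg_left ((le_abs_self _).trans (hB.trans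
    (mul_le_mul_of_nonneg_right (hB2.trans hGH) hZ0))) hRa.le
  have hPo := hp.sq_h1Norm_le_of_integral_eq_zero hΓ hmean
  have hGle : G ≤ H * ((3 + √K) * (Ls⁻¹.toReal * X + 1 / Pr * W * R + Ra * Z)) := by
    have hK0' := Real.sqrt_nonneg K
    -- The slack left when the three separate coefficients are raised to the common `3 + √K`.
    have p1 : 0 ≤ H * (√K * (Ls⁻¹.toReal * X) + 3 * (1 / Pr * W * R) + (2 + √K) * (Ra * Z)) := by
      positivity
    linarith
  rcases hH0.eq_or_lt with h0 | hpos
  · rw [← h0]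
    positivity
  · rw [← mul_le_mul_iff_right₀ hpos]
    calc H * H = H ^ 2 := (sq H).symm
      _ ≤ (2 * Γ ^ 2 + 3) * G := hPo
      _ ≤ (2 * Γ ^ 2 + 3) * (H * ((3 + √K) *
          (Ls⁻¹.toReal * X + 1 / Pr * W * R + Ra * Z))) :=
        mul_le_mul_of_nonneg_left hGle (by positivity)
      _ = _ := by ring

end IsSolution

end RayleighBenard

theorem mainTheorem2 (Γ : ℝ) (hΓ : 0 < Γ) :
    (∀ r : ℝ, 2 < r → ∃ C : ℝ, 0 < C ∧
      ∀ (Ra Pr : ℝ) (Ls : ℝ≥0∞), 0 < Ra → 0 < Pr → 0 < Ls →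
      ∀ u₁ u₂ p T : ℝ → ℝ × ℝ → ℝ, RayleighBenard.IsSolution Γ Ra Pr Ls u₁ u₂ p T →
      ∀ t : ℝ, 0 < t → (∫ x in RayleighBenard.cell Γ, p t x) = 0 →
        RayleighBenard.h1Norm Γ (p t) ≤
          C * (Ls⁻¹.toReal *
                RayleighBenard.lpNormVec Γ 2
                  (RayleighBenard.d₂ (u₁ t)) (RayleighBenard.d₂ (u₂ t))
              + 1 / Pr * RayleighBenard.lpNorm Γ 2 (RayleighBenard.vorticity (u₁ t) (u₂ t))
                  * RayleighBenard.lpNorm Γ r (RayleighBenard.vorticity (u₁ t) (u₂ t))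
              + Ra * RayleighBenard.lpNorm Γ 2 (T t))) ∧
    (∀ (Ra Pr : ℝ) (Ls : ℝ≥0∞), 0 < Ra → 0 < Pr → 0 < Ls →
      ∀ u₁ u₂ p T : ℝ → ℝ × ℝ → ℝ, RayleighBenard.IsSolution Γ Ra Pr Ls u₁ u₂ p T →
      ∀ t : ℝ, 0 < t →
        |∫ x₁ in (0 : ℝ)..Γ,
            (p t (x₁, 1) * RayleighBenard.d₁ (u₁ t) (x₁, 1)
              + p t (x₁, 0) * RayleighBenard.d₁ (u₁ t) (x₁, 0))|
          ≤ 3 * RayleighBenard.h1Norm Γ (p t) *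
              RayleighBenard.lpNormVec Γ 2
                (RayleighBenard.d₂ (u₁ t)) (RayleighBenard.d₂ (u₂ t))) := by
  refine ⟨fun r hr => ?_, fun Ra Pr Ls _ _ _ u₁ u₂ p T h t ht => ?_⟩
  · obtain ⟨C, hC, hle⟩ := RayleighBenard.IsSolution.exists_h1Norm_pressure_le hΓ hr
    exact ⟨C, hC, fun Ra Pr Ls hRa hPr _ => hle Ra Pr Ls hRa hPr⟩
  · exact RayleighBenard.abs_integral_wall_le hΓ (h.periodicC2_fst ht)
      (h.periodicC2_snd ht).periodicC1 (h.periodicC1_pressure ht) (h.incompressible t ht)
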